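/- Let $n\ge 3$ be an integer and let $K\subset\mathbb R^2$ be a convex body (a compact convex set with non-empty interior) with $o\in\operatorname{int}K$ that has $n$-fold rotational symmetry about some point of the plane (not necessarily the origin $o$). Let $K^*=\{x\in\mathbb R^2: \langle x,y\rangle\le 1\ \text{for all } y\in K\}$ be the polar of $K$ with respect to $o$, let $|\cdot|$ denote area, and suppose that $$|K|\cdot|K^*|\le (1+\varepsilon)\,n^2\sin^2(\pi/n)\qquad\text{with } \varepsilon>0 .$$ (1) For every regular $n$-gon $R_n$ one has $\delta^s_{BM}(K,R_n)\le 1+18\varepsilon$. Here the similarity Banach--Mazur distance $\delta^s_{BM}(K,L)$ is the minimum of $\lambda_2/\lambda_1$ over all $\lambda_1,\lambda_2>0$ for which there are a similarity $A$ of the plane and $x\in\mathbb R^2$ with $\lambda_1A(K)\subset L\subset\lambda_2A(K)+x$. (In particular, some such $\lambda_1,\lambda_2,A,x$ for $L=R_n$ satisfy $\lambda_2/\lambda_1\le 1+18\varepsilon$.) (2) Let $x\in\mathbb R^2$, $\lambda_1,\lambda_2>0$, and let $R_n$ be a regular $n$-gon with $$\lambda_1R_n+x\subset K\subset\lambda_2R_n+x\qquad\text{and}\qquad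 \lambda_2/\lambda_1\le 1+18\varepsilon<1/\cos(\pi/n).$$ Then, in the Euclidean norm rescaled so that $[(\lambda_1+\lambda_2)/2]R_n$ has diameter $1$, the distance from $o$ of the centre of $[(\lambda_1+\lambda_2)/2]R_n+x$ is at most $263\sqrt{\varepsilon}$; that is, in the standard norm this distance is at most $263\sqrt{\varepsilon}\cdot\operatorname{diam}\bigl([(\lambda_1+\lambda_2)/2]R_n\bigr)$. -/

import Mathlib

open Set MeasureTheory
open scoped Pointwise

noncomputable section

/-- The Euclidean plane. -/
abbrev Plane : Type := EuclideanSpace ℝ (Fin 2)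

/-- Rotation of the plane about the origin by the angle `θ` (counterclockwise). -/
def rot (θ : ℝ) (v : Plane) : Plane :=
  !₂[Real.cos θ * v 0 - Real.sin θ * v 1, Real.sin θ * v 0 + Real.cos θ * v 1]

/-- A planar convex body: a compact convex set with non-empty interior. -/
structure IsPlanarConvexBody (K : Set Plane) : Prop where
  convex : Convex ℝ K
  isCompact : IsCompact K
  interior_nonempty : (interior K).Nonempty

/-- The polar body of `K` with respect to the unit circle centred at the origin. -/
def polarBody (K : Set Plane) : Set Plane :=
  {x | ∀ y ∈ K, inner ℝ x y ≤ 1}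

/-- `K` has `n`-fold rotational symmetry about the point `s`: it is mapped onto itself by the
rotation about `s` by the angle `2π/n`. -/
def HasNFoldSymmetryAbout (n : ℕ) (s : Plane) (K : Set Plane) : Prop :=
  (fun y : Plane => s + rot (2 * Real.pi / n) (y - s)) '' K = K

/-- `K` is `n`-fold rotationally symmetric (about some point of the plane). -/
def IsNFoldSymmetric (n : ℕ) (K : Set Plane) : Prop :=
  ∃ s : Plane, HasNFoldSymmetryAbout n s K

/-- `R` is a regular `n`-gon (as a convex body) with centre `c`. -/
def IsRegularNGon (n : ℕ) (c : Plane) (R : Set Plane) : Prop :=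
  ∃ v : Plane, v ≠ 0 ∧
    R = convexHull ℝ {p | ∃ k : ℕ, k < n ∧ p = c + rot (2 * Real.pi * k / n) v}

/-- The set of the ratios `l₂ / l₁`, where `l₁, l₂ > 0` and, for some similarity `A` of the plane
and some vector `x`, one has `l₁ A(K) ⊆ L ⊆ l₂ A(K) + x`. -/
def similarityRatios (K L : Set Plane) : Set ℝ :=
  {ρ | ∃ (l₁ l₂ : ℝ) (A : Plane ≃ᵈ Plane) (x : Plane), 0 < l₁ ∧ 0 < l₂ ∧
    l₁ • (A '' K) ⊆ L ∧ L ⊆ x +ᵥ l₂ • (A '' K) ∧ ρ = l₂ / l₁}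

/-- The similarity Banach–Mazur distance `δˢ_BM(K, L)`. -/
def similarityBanachMazur (K L : Set Plane) : ℝ :=
  sInf (similarityRatios K L)

end

/-! Translate the symmetry centre `s` of `K` to the origin, giving `L`, and let `p` be a point of
`L` of maximal norm `ρ`. The disc of radius `1/ρ` then lies in the polar of `L`, and both bodies
have boundary points on the rays through the orbit of `p`. Let `u` be the unit bisector of `p` and
its next rotation, `h` and `r` the support and radial functions of `L` at `u`, and `c = cos(π/n)`.

Two lower bounds for the volume product come from areas in sectors. Full sectors of angle `2π/n`
contain quadrilaterals, which gives a multiple of `h/r`. Half sectors give a second bound: the area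
bound of a sector of `L` is linear in the point, hence yields a point of the polar, which is
inserted in the area bound for the polar (`inner_div_four_le_area_mul_area`). Together, in
`volume_product_stability`, they prove the sharp inequality for `L` and force `h` to be close to `ρ
c`. Hence `L` lies between the regular polygon spanned by the orbit of `p` and a slight dilate of
it, which is part (1).

For part (2), moving the pole of polarity from the centre to a point `z` multiplies the area element
of the polar by `(1 - ⟨z,y⟩)⁻³` under a projective map. The linear term integrates to zero by
symmetry and the quadratic term gives a definite gain (`volume_polarBody_shift_ge`), so `‖s‖` is of
order `√ε ρ`. Averaging squared norms over orbits then shows that the centre of any tightly fitting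
polygon is near `s` (`norm_center_le`). -/

/-! ### Wedge product and rotations of the plane. -/

/-- The oriented area of the parallelogram spanned by two vectors of the plane. -/
def wedge (v w : Plane) : ℝ := v 0 * w 1 - v 1 * w 0

@[simp] theorem rot_apply_zero (θ : ℝ) (v : Plane) :
    rot θ v 0 = Real.cos θ * v 0 - Real.sin θ * v 1 := by simp [rot]

@[simp] theorem rot_apply_one (θ : ℝ) (v : Plane) :
    rot θ v 1 = Real.sin θ * v 0 + Real.cos θ * v 1 := by simp [rot]

theorem plane_ext {v w : Plane} (h0 : v 0 = w 0) (h1 : v 1 = w 1) : v = w := by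
  ext i; fin_cases i
  · exact h0
  · exact h1

theorem plane_inner (v w : Plane) : inner ℝ v w = v 0 * w 0 + v 1 * w 1 := by
  simp [PiLp.inner_apply, Fin.sum_univ_two, mul_comm]

theorem rot_rot (a b : ℝ) (v : Plane) : rot a (rot b v) = rot (a + b) v := by
  apply plane_ext <;> simp [Real.cos_add, Real.sin_add] <;> ring

theorem rot_zero_angle (v : Plane) : rot 0 v = v := by
  apply plane_ext <;> simp

theorem rot_add_two_pi (θ : ℝ) (v : Plane) : rot (θ + 2 * Real.pi) v = rot θ v := by
  apply plane_ext <;> simp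

theorem inner_rot_rot (a b : ℝ) (v w : Plane) :
    inner ℝ (rot a v) (rot b w) = Real.cos (b - a) * inner ℝ v w - Real.sin (b - a) * wedge v w := by
  simp only [plane_inner, wedge, rot_apply_zero, rot_apply_one, Real.cos_sub, Real.sin_sub]; ring

theorem wedge_rot_rot (a b : ℝ) (v w : Plane) :
    wedge (rot a v) (rot b w) = Real.cos (b - a) * wedge v w + Real.sin (b - a) * inner ℝ v w := by
  simp only [plane_inner, wedge, rot_apply_zero, rot_apply_one, Real.cos_sub, Real.sin_sub]; ring

theorem wedge_self (v : Plane) : wedge v v = 0 := by simp [wedge]; ring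

/-- The rotation about the origin as a linear isometry. -/
noncomputable def rotIso (θ : ℝ) : Plane ≃ₗᵢ[ℝ] Plane where
  toFun := rot θ
  invFun := rot (-θ)
  map_add' v w := by apply plane_ext <;> simp <;> ring
  map_smul' t v := by apply plane_ext <;> simp <;> ring
  left_inv v := by simp [rot_rot, rot_zero_angle]
  right_inv v := by simp [rot_rot, rot_zero_angle]
  norm_map' v := by
    have h : ‖rot θ v‖ ^ 2 = ‖v‖ ^ 2 := by
      rw [← real_inner_self_eq_norm_sq, inner_rot_rot, ← real_inner_self_eq_norm_sq]; simp
    exact (pow_left_inj₀ (norm_nonneg _) (norm_nonneg _) two_ne_zero).1 h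

@[simp] theorem coe_rotIso (θ : ℝ) (v : Plane) : rotIso θ v = rot θ v := rfl

theorem rot_add (θ : ℝ) (v w : Plane) : rot θ (v + w) = rot θ v + rot θ w := (rotIso θ).map_add v w

theorem rot_smul (θ t : ℝ) (v : Plane) : rot θ (t • v) = t • rot θ v := (rotIso θ).map_smul t v

theorem norm_rot (θ : ℝ) (v : Plane) : ‖rot θ v‖ = ‖v‖ := (rotIso θ).norm_map v

theorem measurePreserving_rot (θ : ℝ) : MeasurePreserving (rot θ) volume volume :=
  (rotIso θ).measurePreserving

theorem eq_zero_of_rot_eq {θ : ℝ} (hθ : Real.cos θ ≠ 1) {v : Plane} (h : rot θ v = v) : v = 0 := by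
  have h1 : inner ℝ v (rot θ v) = Real.cos θ * ‖v‖ ^ 2 := by
    have := inner_rot_rot 0 θ v v
    rw [rot_zero_angle, wedge_self, real_inner_self_eq_norm_sq] at this
    simpa using this
  rw [h, real_inner_self_eq_norm_sq] at h1
  have h2 : (1 - Real.cos θ) * ‖v‖ ^ 2 = 0 := by linarith
  rcases mul_eq_zero.1 h2 with h3 | h3
  · exact absurd (by linarith) hθ
  · simpa using h3

theorem cos_two_pi_div_ne_one {n : ℕ} (hn : 2 ≤ n) : Real.cos (2 * Real.pi / n) ≠ 1 := by
  have hn' : (2 : ℝ) ≤ n := by exact_mod_cast hn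
  have h1 : 0 < 2 * Real.pi / n := by positivity
  have h2 : 2 * Real.pi / n < 2 * Real.pi := by
    rw [div_lt_iff₀ (by linarith)]; nlinarith [Real.pi_pos]
  intro h
  rw [Real.cos_eq_one_iff_of_lt_of_lt (by linarith) h2] at h
  linarith

/-- Rotation by `2π/n` only shifts the index, so it fixes the sum; its only fixed point is the
origin. -/
theorem sum_rot_eq_zero {n : ℕ} (hn : 2 ≤ n) (v : Plane) :
    ∑ k ∈ Finset.range n, rot (2 * Real.pi * k / n) v = 0 := by
  have hn0 : (n : ℝ) ≠ 0 := by positivity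
  apply eq_zero_of_rot_eq (cos_two_pi_div_ne_one hn)
  have h := map_sum (rotIso (2 * Real.pi / n)) (fun k : ℕ => rot (2 * Real.pi * k / n) v)
    (Finset.range n)
  simp only [coe_rotIso, rot_rot] at h
  rw [h]
  have h1 : ∀ k : ℕ, rot (2 * Real.pi / n + 2 * Real.pi * k / n) v =
      rot (2 * Real.pi * (k + 1 : ℕ) / n) v := by
    intro k; congr 1; push_cast; ring
  simp only [h1]
  have h2 := Finset.sum_range_succ (fun k : ℕ => rot (2 * Real.pi * k / n) v) n
  rw [Finset.sum_range_succ'] at h2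
  have h3 : rot (2 * Real.pi * (n : ℕ) / n) v = rot (2 * Real.pi * (0 : ℕ) / n) v := by
    have : 2 * Real.pi * n / n = 2 * Real.pi * (0 : ℕ) / n + 2 * Real.pi := by
      field_simp; simp
    rw [this, rot_add_two_pi]
  rw [h3] at h2
  exact add_right_cancel h2

/-- On averaging over the orbit, the cross terms cancel because the rotated copies of `e` sum to
zero. -/
theorem norm_sq_add_norm_sq_le_of_rot {n : ℕ} (hn : 2 ≤ n) {d e : Plane} {M : ℝ}
    (h : ∀ k < n, ‖d + rot (2 * Real.pi * k / n) e‖ ^ 2 ≤ M) : ‖d‖ ^ 2 + ‖e‖ ^ 2 ≤ M := by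
  have h1 : ∑ k ∈ Finset.range n, ‖d + rot (2 * Real.pi * k / n) e‖ ^ 2 ≤ n * M := by
    have := Finset.sum_le_card_nsmul (Finset.range n) _ M (fun k hk => h k (Finset.mem_range.1 hk))
    simpa using this
  have h2 : ∑ k ∈ Finset.range n, ‖d + rot (2 * Real.pi * k / n) e‖ ^ 2 =
      n * (‖d‖ ^ 2 + ‖e‖ ^ 2) := by
    have : ∀ k : ℕ, ‖d + rot (2 * Real.pi * k / n) e‖ ^ 2 =
        (‖d‖ ^ 2 + ‖e‖ ^ 2) + 2 * inner ℝ d (rot (2 * Real.pi * k / n) e) := by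
      intro k; rw [norm_add_sq_real, norm_rot]; ring
    simp only [this]
    rw [Finset.sum_add_distrib, ← Finset.mul_sum, ← inner_sum, sum_rot_eq_zero hn]
    simp; ring
  rw [h2] at h1
  exact le_of_mul_le_mul_left h1 (by positivity)

theorem exists_eq_smul_rot {w : Plane} (hw : w ≠ 0) (v : Plane) :
    ∃ r φ : ℝ, 0 ≤ r ∧ 0 ≤ φ ∧ φ < 2 * Real.pi ∧ v = r • rot φ w := by
  set W : ℂ := ⟨w 0, w 1⟩ with hW
  set V : ℂ := ⟨v 0, v 1⟩ with hV
  have hW0 : W ≠ 0 := by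
    intro h
    apply hw
    have h0 := congrArg Complex.re h
    have h1 := congrArg Complex.im h
    exact plane_ext (by simpa [hW] using h0) (by simpa [hW] using h1)
  set q := V / W with hq
  have hV' : V = q * W := by rw [hq]; field_simp
  have key : v = ‖q‖ • rot q.arg w := by
    have hre := Complex.norm_mul_cos_arg q
    have him := Complex.norm_mul_sin_arg q
    have h0 := congrArg Complex.re hV'
    have h1 := congrArg Complex.im hV'
    simp only [Complex.mul_re, Complex.mul_im, hV, hW] at h0 h1
    apply plane_ext
    · simp only [PiLp.smul_apply, smul_eq_mul, rot_apply_zero]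
      rw [h0, ← hre, ← him]; ring
    · simp only [PiLp.smul_apply, smul_eq_mul, rot_apply_one]
      rw [h1, ← hre, ← him]; ring
  have h1 := Complex.neg_pi_lt_arg q
  have h2 := Complex.arg_le_pi q
  by_cases h : 0 ≤ q.arg
  · exact ⟨‖q‖, q.arg, norm_nonneg _, h, by linarith [Real.pi_pos], key⟩
  · refine ⟨‖q‖, q.arg + 2 * Real.pi, norm_nonneg _, by linarith, by linarith, ?_⟩
    rw [rot_add_two_pi]; exact key

/-! ### Areas of triangles and of sectors of a convex set. -/

/-- The linear endomorphism of the plane that maps the standard basis to `P`, `Q`. -/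
noncomputable def basisMap (P Q : Plane) : Plane →ₗ[ℝ] Plane where
  toFun v := v 0 • P + v 1 • Q
  map_add' v w := by simp only [PiLp.add_apply]; module
  map_smul' t v := by simp only [PiLp.smul_apply, smul_eq_mul, RingHom.id_apply]; module

theorem plane_det (f : Plane →ₗ[ℝ] Plane) :
    LinearMap.det f = wedge (f !₂[1, 0]) (f !₂[0, 1]) := by
  have h0 : EuclideanSpace.single (0 : Fin 2) (1 : ℝ) = !₂[1, 0] := by
    apply plane_ext <;> simp
  have h1 : EuclideanSpace.single (1 : Fin 2) (1 : ℝ) = !₂[0, 1] := by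
    apply plane_ext <;> simp
  rw [← LinearMap.det_toMatrix (EuclideanSpace.basisFun (Fin 2) ℝ).toBasis, Matrix.det_fin_two]
  simp [LinearMap.toMatrix_apply, wedge, h0, h1]
  ring

theorem det_basisMap (P Q : Plane) : LinearMap.det (basisMap P Q) = wedge P Q := by
  rw [plane_det]; simp [basisMap, wedge]

/-- The open triangle with the vertices `0`, `P`, `Q`. -/
def openTriangle (P Q : Plane) : Set Plane :=
  {v | ∃ s t : ℝ, 0 < s ∧ 0 < t ∧ s + t < 1 ∧ v = s • P + t • Q}

theorem volume_standard_triangle :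
    volume {p : ℝ × ℝ | 0 < p.1 ∧ 0 < p.2 ∧ p.1 + p.2 < 1} = ENNReal.ofReal (1 / 2) := by
  have h : {p : ℝ × ℝ | 0 < p.1 ∧ 0 < p.2 ∧ p.1 + p.2 < 1} =
      regionBetween (fun _ : ℝ => (0 : ℝ)) (fun s => 1 - s) (Ioo 0 1) := by
    ext p
    simp only [regionBetween, mem_ofPred_eq, mem_Ioo]
    constructor
    · rintro ⟨h1, h2, h3⟩; exact ⟨⟨h1, by linarith⟩, h2, by linarith⟩
    · rintro ⟨⟨h1, h2⟩, h3, h4⟩; exact ⟨h1, h3, by linarith⟩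
  have hi : IntegrableOn (fun s : ℝ => 1 - s) (Ioo 0 1) :=
    ((continuous_const.sub continuous_id).integrableOn_Icc (a := (0 : ℝ)) (b := 1)).mono_set
      Ioo_subset_Icc_self
  rw [h, Measure.volume_eq_prod, volume_regionBetween_eq_integral integrableOn_zero hi
    measurableSet_Ioo]
  · congr 1
    simp only [Pi.sub_apply, sub_zero]
    rw [← integral_Ioc_eq_integral_Ioo, ← intervalIntegral.integral_of_le zero_le_one]
    rw [intervalIntegral.integral_sub (by simp) (by simp)]
    simp; norm_num
  · intro x hx; simp only [mem_Ioo] at hx; linarith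

theorem volume_openTriangle (P Q : Plane) :
    volume (openTriangle P Q) = ENNReal.ofReal (|wedge P Q| / 2) := by
  have h1 : openTriangle P Q = basisMap P Q '' {v : Plane | 0 < v 0 ∧ 0 < v 1 ∧ v 0 + v 1 < 1} := by
    ext v
    constructor
    · rintro ⟨s, t, hs, ht, hst, rfl⟩
      exact ⟨!₂[s, t], by simpa using ⟨hs, ht, hst⟩, by simp [basisMap]⟩
    · rintro ⟨w, ⟨hs, ht, hst⟩, rfl⟩
      exact ⟨w 0, w 1, hs, ht, hst, rfl⟩
  have hmp : MeasurePreserving (fun v : Plane => (v 0, v 1)) volume volume :=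
    (volume_preserving_finTwoArrow ℝ).comp
      (PiLp.volume_preserving_ofLp (Fin 2))
  have h2 : volume {v : Plane | 0 < v 0 ∧ 0 < v 1 ∧ v 0 + v 1 < 1} = ENNReal.ofReal (1 / 2) := by
    rw [← volume_standard_triangle, ← hmp.measure_preimage]
    · rfl
    · apply MeasurableSet.nullMeasurableSet
      apply IsOpen.measurableSet
      exact ((isOpen_lt continuous_const continuous_fst).inter
        ((isOpen_lt continuous_const continuous_snd).inter
          (isOpen_lt (continuous_fst.add continuous_snd) continuous_const)))
  rw [h1, Measure.addHaar_image_linearMap, h2, det_basisMap, ← ENNReal.ofReal_mul (abs_nonneg _)]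
  congr 1; ring

/-- The open convex cone between the rays through `P` and `Q`. -/
def openCone (P Q : Plane) : Set Plane := {v | 0 < wedge P v ∧ 0 < wedge v Q}

theorem continuous_wedge {X : Type*} [TopologicalSpace X] {f g : X → Plane} (hf : Continuous f)
    (hg : Continuous g) : Continuous fun x => wedge (f x) (g x) := by
  unfold wedge; fun_prop

theorem isOpen_openCone (P Q : Plane) : IsOpen (openCone P Q) :=
  (isOpen_lt continuous_const (continuous_wedge continuous_const continuous_id)).inter
    (isOpen_lt continuous_const (continuous_wedge continuous_id continuous_const))

theorem eq_combo_of_wedge_ne_zero {P Q : Plane} (h : wedge P Q ≠ 0) (v : Plane) :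
    v = (wedge v Q / wedge P Q) • P + (wedge P v / wedge P Q) • Q := by
  apply plane_ext <;> simp only [PiLp.add_apply, PiLp.smul_apply, smul_eq_mul] <;> field_simp <;>
    simp [wedge] <;> ring

theorem openTriangle_subset {L : Set Plane} (hL : Convex ℝ L) (h0 : (0 : Plane) ∈ L) {P Q : Plane}
    (hP : P ∈ L) (hQ : Q ∈ L) : openTriangle P Q ⊆ L := by
  rintro v ⟨s, t, hs, ht, hst, rfl⟩
  have := hL.sum_mem (t := Finset.univ) (w := ![s, t, 1 - s - t]) (z := ![P, Q, 0])
    (by intro i _; fin_cases i <;> simp <;> linarith) (by simp [Fin.sum_univ_three])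
    (by intro i _; fin_cases i <;> simp [hP, hQ, h0])
  simpa [Fin.sum_univ_three] using this

theorem openTriangle_subset_cone {P Q A B : Plane} (h1 : 0 ≤ wedge P A) (h2 : 0 ≤ wedge P B)
    (h3 : 0 < wedge P A + wedge P B) (h4 : 0 ≤ wedge A Q) (h5 : 0 ≤ wedge B Q)
    (h6 : 0 < wedge A Q + wedge B Q) : openTriangle A B ⊆ openCone P Q := by
  rintro v ⟨s, t, hs, ht, hst, rfl⟩
  have e1 : wedge P (s • A + t • B) = s * wedge P A + t * wedge P B := by simp [wedge]; ring
  have e2 : wedge (s • A + t • B) Q = s * wedge A Q + t * wedge B Q := by simp [wedge]; ring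
  refine ⟨?_, ?_⟩
  · rw [e1]
    rcases h1.eq_or_lt with h | h
    · rw [← h] at h3 ⊢; nlinarith
    · nlinarith [mul_nonneg ht.le h2, mul_pos hs h]
  · rw [e2]
    rcases h4.eq_or_lt with h | h
    · rw [← h] at h6 ⊢; nlinarith
    · nlinarith [mul_nonneg ht.le h5, mul_pos hs h]

/-- `P` is the last point of `L` on the ray from the origin through `P`. -/
def IsRadialEnd (L : Set Plane) (P : Plane) : Prop := P ∈ L ∧ ∀ t : ℝ, 1 < t → t • P ∉ L

/-- If `x` lies in the cone, the disjoint triangles `0Px` and `0xQ` fit in the sector. Otherwise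
convexity and the radial ends bound the left side by the area of `0PQ`, so no position of `x` has to
be assumed. -/
theorem wedge_add_wedge_le_area {L : Set Plane} (hL : Convex ℝ L) (hfin : volume L ≠ ⊤)
    (h0 : (0 : Plane) ∈ L) {P Q : Plane} (hP : IsRadialEnd L P) (hQ : IsRadialEnd L Q)
    (hPQ : 0 < wedge P Q) {x : Plane} (hx : x ∈ L) :
    (wedge P x + wedge x Q) / 2 ≤ volume.real (L ∩ openCone P Q) := by
  have hfin' : volume (L ∩ openCone P Q) ≠ ⊤ := measure_ne_top_of_subset inter_subset_left hfin
  set a := wedge x Q / wedge P Q with ha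
  set b := wedge P x / wedge P Q with hb
  have hxe : x = a • P + b • Q := eq_combo_of_wedge_ne_zero hPQ.ne' x
  have hxQ : wedge x Q = a * wedge P Q := by rw [ha]; field_simp
  have hPx : wedge P x = b * wedge P Q := by rw [hb]; field_simp
  have area : ∀ A B : Plane, openTriangle A B ⊆ L ∩ openCone P Q → 0 ≤ wedge A B →
      wedge A B / 2 ≤ volume.real (L ∩ openCone P Q) := by
    intro A B hAB hpos
    have := measureReal_mono hAB hfin'
    rwa [Measure.real, volume_openTriangle, ENNReal.toReal_ofReal (by positivity),
      abs_of_nonneg hpos] at this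
  have hPQsub : openTriangle P Q ⊆ L ∩ openCone P Q :=
    subset_inter (openTriangle_subset hL h0 hP.1 hQ.1)
      (openTriangle_subset_cone (by rw [wedge_self]) hPQ.le (by rw [wedge_self]; linarith)
        hPQ.le (by rw [wedge_self]) (by rw [wedge_self]; linarith))
  have hbig := area P Q hPQsub hPQ.le
  by_cases hab : a + b ≤ 1
  · rw [hPx, hxQ]
    nlinarith
  push Not at hab
  have hb0 : 0 ≤ b := by
    by_contra hneg
    push Not at hneg
    -- The segment from `x` to `Q` crosses the ray of `P` at this multiple of `P`, beyond the radial
    -- end.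
    apply hP.2 (a / (1 - b)) (by rw [lt_div_iff₀ (by linarith)]; linarith)
    have hd : (1 - b) ≠ 0 := by linarith
    have := hL hx hQ.1 (a := 1 / (1 - b)) (b := -b / (1 - b)) (div_nonneg (by linarith) (by linarith))
      (div_nonneg (by linarith) (by linarith)) (by field_simp; ring)
    convert this using 1
    rw [hxe, smul_add, smul_smul, smul_smul, add_assoc, ← add_smul]
    have : 1 / (1 - b) * b + -b / (1 - b) = 0 := by field_simp; ring
    rw [this, zero_smul, add_zero]; congr 1; ring
  have ha0 : 0 ≤ a := by
    by_contra hneg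
    push Not at hneg
    apply hQ.2 (b / (1 - a)) (by rw [lt_div_iff₀ (by linarith)]; linarith)
    have hd : (1 - a) ≠ 0 := by linarith
    have := hL hx hP.1 (a := 1 / (1 - a)) (b := -a / (1 - a)) (div_nonneg (by linarith) (by linarith))
      (div_nonneg (by linarith) (by linarith)) (by field_simp; ring)
    convert this using 1
    rw [hxe, smul_add, smul_smul, smul_smul, add_right_comm, ← add_smul]
    have : 1 / (1 - a) * a + -a / (1 - a) = 0 := by field_simp; ring
    rw [this, zero_smul, zero_add]; congr 1; ring
  have hPx0 : 0 ≤ wedge P x := by rw [hPx]; positivity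
  have hxQ0 : 0 ≤ wedge x Q := by rw [hxQ]; positivity
  rcases hb0.eq_or_lt with hb0 | hb0
  · have hle : a ≤ 1 := by
      by_contra hlt
      push Not at hlt
      apply hP.2 a hlt
      rw [hxe, ← hb0, zero_smul, add_zero] at hx
      exact hx
    rw [hPx, hxQ, ← hb0]; nlinarith
  rcases ha0.eq_or_lt with ha0 | ha0
  · have hle : b ≤ 1 := by
      by_contra hlt
      push Not at hlt
      apply hQ.2 b hlt
      rw [hxe, ← ha0, zero_smul, zero_add] at hx
      exact hx
    rw [hPx, hxQ, ← ha0]; nlinarith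
  have hPx1 : 0 < wedge P x := by rw [hPx]; positivity
  have hxQ1 : 0 < wedge x Q := by rw [hxQ]; positivity
  have hs1 : openTriangle P x ⊆ L ∩ openCone P Q :=
    subset_inter (openTriangle_subset hL h0 hP.1 hx)
      (openTriangle_subset_cone (by rw [wedge_self]) hPx0 (by rw [wedge_self]; linarith)
        hPQ.le hxQ0 (by linarith))
  have hs2 : openTriangle x Q ⊆ L ∩ openCone P Q :=
    subset_inter (openTriangle_subset hL h0 hx hQ.1)
      (openTriangle_subset_cone hPx0 hPQ.le (by linarith) hxQ0 (by rw [wedge_self])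
        (by rw [wedge_self]; linarith))
  -- The line through `0` and `x` separates the two triangles, so their areas add.
  have hdisj : Disjoint (openTriangle P x) (openCone x Q) := by
    rw [Set.disjoint_left]
    rintro v ⟨s, t, hs, ht, -, rfl⟩ ⟨h1, -⟩
    have : wedge x (s • P + t • x) = - (s * wedge P x) := by simp [wedge]; ring
    rw [this] at h1
    nlinarith
  have hs3 : openTriangle x Q ⊆ openCone x Q :=
    openTriangle_subset_cone (by rw [wedge_self]) hxQ0 (by rw [wedge_self]; linarith)
        hxQ0 (by rw [wedge_self]) (by rw [wedge_self]; linarith)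
  have hm : volume (openTriangle P x) + volume (openTriangle x Q) ≤
      volume (L ∩ openCone P Q) := by
    have hd := measure_inter_add_sdiff (μ := volume) (L ∩ openCone P Q)
      (isOpen_openCone x Q).measurableSet
    rw [← hd, add_comm]
    refine add_le_add (measure_mono (subset_inter hs2 hs3)) (measure_mono ?_)
    exact fun v hv => ⟨hs1 hv, Set.disjoint_left.1 hdisj hv⟩
  rw [volume_openTriangle, volume_openTriangle, ← ENNReal.ofReal_add (by positivity) (by positivity),
    abs_of_pos hPx1, abs_of_pos hxQ1] at hm
  have := ENNReal.toReal_mono hfin' hm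
  rw [ENNReal.toReal_ofReal (by positivity)] at this
  rw [Measure.real]; linarith

/-! ### Decomposition of a symmetric set into angular sectors. -/

theorem wedge_smul_rot (a b r : ℝ) (w : Plane) :
    wedge (rot a w) (r • rot b w) = r * ‖w‖ ^ 2 * Real.sin (b - a) := by
  have : wedge (rot a w) (r • rot b w) = r * wedge (rot a w) (rot b w) := by simp [wedge]; ring
  rw [this, wedge_rot_rot, wedge_self, real_inner_self_eq_norm_sq]; ring

theorem wedge_smul_rot' (a b r : ℝ) (w : Plane) :
    wedge (r • rot a w) (rot b w) = r * ‖w‖ ^ 2 * Real.sin (b - a) := by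
  have : wedge (r • rot a w) (rot b w) = r * wedge (rot a w) (rot b w) := by simp [wedge]; ring
  rw [this, wedge_rot_rot, wedge_self, real_inner_self_eq_norm_sq]; ring

/-- An angle on the wrong side of `a` or `b` makes one of the two sines nonpositive; if its argument
lies below `-π`, the other sine, shifted by a full turn, does so. -/
theorem angle_mem_of_sin_pos {a b φ : ℝ} (ha : 0 ≤ a) (hab : a < b)
    (hb : b ≤ 2 * Real.pi) (hφ : 0 ≤ φ) (hφ2 : φ < 2 * Real.pi)
    (h1 : 0 < Real.sin (φ - a)) (h2 : 0 < Real.sin (b - φ)) : a < φ ∧ φ < b := by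
  have hpi := Real.pi_pos
  have hp : ∀ y : ℝ, -Real.pi ≤ y → y ≤ 0 → ¬ 0 < Real.sin y := fun y hy1 hy2 h =>
    absurd (Real.sin_nonpos_of_nonpos_of_neg_pi_le hy2 hy1) (not_le.2 h)
  constructor
  · by_contra hle
    push Not at hle
    by_cases hc : -Real.pi ≤ φ - a
    · exact hp _ hc (by linarith) h1
    · push Not at hc
      apply hp (b - φ - 2 * Real.pi) (by linarith) (by linarith)
      rwa [Real.sin_sub_two_pi]
  · by_contra hle
    push Not at hle
    by_cases hc : -Real.pi ≤ b - φ
    · exact hp _ hc (by linarith) h2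
    · push Not at hc
      apply hp (φ - a - 2 * Real.pi) (by linarith) (by linarith)
      rwa [Real.sin_sub_two_pi]

theorem pairwise_disjoint_openCone {m : ℕ} (hm : 3 ≤ m) {w : Plane} (hw : w ≠ 0) :
    (↑(Finset.range m) : Set ℕ).PairwiseDisjoint fun j : ℕ =>
      openCone (rot (2 * Real.pi * j / m) w) (rot (2 * Real.pi * (j + 1) / m) w) := by
  have hm' : (3 : ℝ) ≤ m := by exact_mod_cast hm
  have hpi := Real.pi_pos
  have key : ∀ j < m, ∀ r φ : ℝ, 0 ≤ r → 0 ≤ φ → φ < 2 * Real.pi →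
      r • rot φ w ∈ openCone (rot (2 * Real.pi * j / m) w) (rot (2 * Real.pi * (j + 1) / m) w) →
      2 * Real.pi * j / m < φ ∧ φ < 2 * Real.pi * (j + 1) / m := by
    rintro j hj r φ hr hφ hφ2 ⟨h1, h2⟩
    have hj' : (j : ℝ) + 1 ≤ m := by exact_mod_cast hj
    rw [wedge_smul_rot] at h1
    rw [wedge_smul_rot'] at h2
    have hc : 0 ≤ r * ‖w‖ ^ 2 := by positivity
    refine angle_mem_of_sin_pos (by positivity) (by gcongr; linarith) ?_ hφ hφ2
      (pos_of_mul_pos_right h1 hc) (pos_of_mul_pos_right h2 hc)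
    rw [div_le_iff₀ (by linarith)]; nlinarith
  intro i hi j hj hij
  rw [Function.onFun, Set.disjoint_left]
  intro v hvi hvj
  obtain ⟨r, φ, hr, hφ, hφ2, rfl⟩ := exists_eq_smul_rot hw v
  have hi' := key i (by simpa using hi) r φ hr hφ hφ2 hvi
  have hj' := key j (by simpa using hj) r φ hr hφ hφ2 hvj
  have h1 := hi'.1.trans hj'.2
  have h2 := hj'.1.trans hi'.2
  rw [div_lt_div_iff_of_pos_right (by linarith), mul_lt_mul_iff_right₀ (by positivity)] at h1 h2
  have h1' : i < j + 1 := by exact_mod_cast h1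
  have h2' : j < i + 1 := by exact_mod_cast h2
  omega

theorem sum_volume_openCone_le {m : ℕ} (hm : 3 ≤ m) {w : Plane} (hw : w ≠ 0) {L : Set Plane}
    (hL : MeasurableSet L) (hfin : volume L ≠ ⊤) :
    ∑ j ∈ Finset.range m, volume.real
      (L ∩ openCone (rot (2 * Real.pi * j / m) w) (rot (2 * Real.pi * (j + 1) / m) w)) ≤
      volume.real L := by
  rw [← measureReal_biUnion_finset]
  · exact measureReal_mono (iUnion₂_subset fun _ _ => inter_subset_left) hfin
  · exact (pairwise_disjoint_openCone hm hw).mono_on fun j _ => inter_subset_right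
  · exact fun j _ => hL.inter (isOpen_openCone _ _).measurableSet

theorem rot_mem_iff {n : ℕ} {L : Set Plane} (hsym : ∀ v, rot (2 * Real.pi / n) v ∈ L ↔ v ∈ L)
    (k : ℕ) (v : Plane) : rot (2 * Real.pi * k / n) v ∈ L ↔ v ∈ L := by
  induction k with
  | zero => simp [rot_zero_angle]
  | succ k ih =>
    rw [← ih, ← hsym (rot (2 * Real.pi * k / n) v), rot_rot]
    have : 2 * Real.pi / n + 2 * Real.pi * k / n = 2 * Real.pi * (k + 1 : ℕ) / n := by
      push_cast; ring
    rw [this]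

theorem volume_openCone_rot {θ : ℝ} {L : Set Plane} (hL : MeasurableSet L)
    (hsym : ∀ v, rot θ v ∈ L ↔ v ∈ L) (P Q : Plane) :
    volume.real (L ∩ openCone (rot θ P) (rot θ Q)) = volume.real (L ∩ openCone P Q) := by
  rw [Measure.real, Measure.real, ← (measurePreserving_rot θ).measure_preimage
    (hL.inter (isOpen_openCone _ _).measurableSet).nullMeasurableSet]
  congr 2
  ext v
  simp only [mem_preimage, mem_inter_iff, hsym, openCone, mem_ofPred_eq, wedge_rot_rot]
  simp

theorem card_mul_volume_openCone_le {n : ℕ} (hn : 3 ≤ n) {w : Plane} (hw : w ≠ 0) {L : Set Plane}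
    (hL : MeasurableSet L) (hfin : volume L ≠ ⊤) (hsym : ∀ v, rot (2 * Real.pi / n) v ∈ L ↔ v ∈ L) :
    n * volume.real (L ∩ openCone w (rot (2 * Real.pi / n) w)) ≤ volume.real L := by
  refine le_trans (le_of_eq ?_) (sum_volume_openCone_le hn hw hL hfin)
  have : ∀ j : ℕ, volume.real
      (L ∩ openCone (rot (2 * Real.pi * j / n) w) (rot (2 * Real.pi * (j + 1) / n) w)) =
      volume.real (L ∩ openCone w (rot (2 * Real.pi / n) w)) := by
    intro j
    rw [← volume_openCone_rot hL (rot_mem_iff hsym j) w (rot (2 * Real.pi / n) w), rot_rot]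
    congr 4; ring
  simp [this]

/-- The `2n` sectors of angle `π/n` form two orbits, the even and the odd ones. No reflection
symmetry is available, so their two areas may differ. -/
theorem card_mul_volume_add_le {n : ℕ} (hn : 3 ≤ n) {w : Plane} (hw : w ≠ 0) {L : Set Plane}
    (hL : MeasurableSet L) (hfin : volume L ≠ ⊤) (hsym : ∀ v, rot (2 * Real.pi / n) v ∈ L ↔ v ∈ L) :
    n * (volume.real (L ∩ openCone w (rot (Real.pi / n) w)) +
      volume.real (L ∩ openCone (rot (Real.pi / n) w) (rot (2 * Real.pi / n) w))) ≤
      volume.real L := by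
  have hn0 : (n : ℝ) ≠ 0 := by positivity
  refine le_trans (le_of_eq ?_) (sum_volume_openCone_le (m := 2 * n) (by omega) hw hL hfin)
  have hsplit : ∀ (f : ℕ → ℝ) (k : ℕ), ∑ j ∈ Finset.range (2 * k), f j =
      ∑ j ∈ Finset.range k, (f (2 * j) + f (2 * j + 1)) := by
    intro f k
    induction k with
    | zero => simp
    | succ k ih =>
      rw [Finset.sum_range_succ, ← ih, mul_add, mul_one, Finset.sum_range_succ,
        Finset.sum_range_succ]
      ring
  rw [hsplit]
  have h1 : ∀ j : ℕ, volume.real (L ∩ openCone (rot (2 * Real.pi * (2 * j : ℕ) / (2 * n : ℕ)) w)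
      (rot (2 * Real.pi * ((2 * j : ℕ) + 1) / (2 * n : ℕ)) w)) =
      volume.real (L ∩ openCone w (rot (Real.pi / n) w)) := by
    intro j
    rw [← volume_openCone_rot hL (rot_mem_iff hsym j) w (rot (Real.pi / n) w), rot_rot]
    congr 4
    · push_cast; field_simp
    · push_cast; field_simp
  have h2 : ∀ j : ℕ, volume.real
      (L ∩ openCone (rot (2 * Real.pi * (2 * j + 1 : ℕ) / (2 * n : ℕ)) w)
      (rot (2 * Real.pi * ((2 * j + 1 : ℕ) + 1) / (2 * n : ℕ)) w)) =
      volume.real (L ∩ openCone (rot (Real.pi / n) w) (rot (2 * Real.pi / n) w)) := by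
    intro j
    rw [← volume_openCone_rot hL (rot_mem_iff hsym j) (rot (Real.pi / n) w) (rot (2 * Real.pi / n) w), rot_rot, rot_rot]
    congr 4
    · push_cast; field_simp
    · push_cast; field_simp; ring
  simp only [h1, h2]
  simp; ring

/-! ### Regular polygons as intersections of half-planes. -/

theorem zero_mem_of_rot_mem {n : ℕ} (hn : 2 ≤ n) {L : Set Plane} (hL : Convex ℝ L) {v : Plane}
    (h : ∀ k < n, rot (2 * Real.pi * k / n) v ∈ L) : (0 : Plane) ∈ L := by
  have hn0 : (n : ℝ) ≠ 0 := by positivity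
  have := hL.sum_mem (t := Finset.range n) (w := fun _ => (1 / n : ℝ))
    (z := fun k : ℕ => rot (2 * Real.pi * k / n) v) (fun _ _ => by positivity)
    (by simp [hn0]) (fun k hk => h k (Finset.mem_range.1 hk))
  rwa [← Finset.smul_sum, sum_rot_eq_zero hn, smul_zero] at this

theorem pi_div_bounds {n : ℕ} (hn : 3 ≤ n) : 0 < Real.pi / n ∧ Real.pi / n ≤ Real.pi / 3 := by
  have hn' : (3 : ℝ) ≤ n := by exact_mod_cast hn
  have hpi := Real.pi_pos
  exact ⟨by positivity, by gcongr⟩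

theorem half_le_cos_pi_div {n : ℕ} (hn : 3 ≤ n) : 1 / 2 ≤ Real.cos (Real.pi / n) := by
  obtain ⟨h1, h2⟩ := pi_div_bounds hn
  rw [← Real.cos_pi_div_three]
  exact Real.cos_le_cos_of_nonneg_of_le_pi h1.le (by linarith [Real.pi_pos]) h2

theorem sin_pi_div_pos {n : ℕ} (hn : 3 ≤ n) : 0 < Real.sin (Real.pi / n) := by
  obtain ⟨h1, h2⟩ := pi_div_bounds hn
  exact Real.sin_pos_of_pos_of_lt_pi h1 (by linarith [Real.pi_pos])

/-- In the sector containing `x`, write `x` as a nonnegative combination of the two adjacent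
vertices. The inequality of the edge joining them says exactly that the coefficients sum to at most
`1`; the origin takes the remaining weight. -/
theorem mem_convexHull_regular {n : ℕ} (hn : 3 ≤ n) {w : Plane} (hw : w ≠ 0) {x : Plane}
    (hx : ∀ k < n, inner ℝ x (rot (2 * Real.pi * k / n) (rot (Real.pi / n) w)) ≤
      ‖w‖ ^ 2 * Real.cos (Real.pi / n)) :
    x ∈ convexHull ℝ {p | ∃ k : ℕ, k < n ∧ p = rot (2 * Real.pi * k / n) w} := by
  have hpi := Real.pi_pos
  have hn' : (3 : ℝ) ≤ n := by exact_mod_cast hn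
  have hn0 : (n : ℝ) ≠ 0 := by positivity
  obtain ⟨hα0, hα3⟩ := pi_div_bounds hn
  have hs := sin_pi_div_pos hn
  have hc := half_le_cos_pi_div hn
  obtain ⟨r, φ, hr, hφ, hφ2, rfl⟩ := exists_eq_smul_rot hw x
  set α := Real.pi / n with hα
  have h2α : 2 * Real.pi / n = 2 * α := by rw [hα]; ring
  set k := ⌊φ / (2 * α)⌋₊ with hk
  have hk1 : (k : ℝ) * (2 * α) ≤ φ := by
    rw [← le_div_iff₀ (by positivity)]; exact Nat.floor_le (by positivity)
  have hk2 : φ < (k + 1 : ℝ) * (2 * α) := by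
    rw [← div_lt_iff₀ (by positivity)]; exact Nat.lt_floor_add_one _
  have hkn : k < n := by
    have : (k : ℝ) * (2 * α) < n * (2 * α) := by
      refine hk1.trans_lt (hφ2.trans_eq ?_)
      rw [hα]; field_simp
    exact_mod_cast lt_of_mul_lt_mul_right this (by positivity)
  have hkα : 2 * Real.pi * k / n = k * (2 * α) := by rw [hα]; ring
  set ψ := φ - k * (2 * α) with hψ
  have hmem : ∀ j ≤ n, rot (2 * Real.pi * j / n) w ∈
      convexHull ℝ {p | ∃ k : ℕ, k < n ∧ p = rot (2 * Real.pi * k / n) w} := by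
    intro j hj
    apply subset_convexHull
    rcases hj.eq_or_lt with rfl | hj
    · refine ⟨0, by omega, ?_⟩
      rw [← rot_add_two_pi (2 * Real.pi * (0 : ℕ) / j)]
      congr 1; field_simp; simp
    · exact ⟨j, hj, rfl⟩
  have h0 : (0 : Plane) ∈ convexHull ℝ {p | ∃ k : ℕ, k < n ∧ p = rot (2 * Real.pi * k / n) w} :=
    zero_mem_of_rot_mem (by omega) (convex_convexHull ℝ _) fun k hk => hmem k hk.le
  have hw2 : 0 < ‖w‖ ^ 2 := by positivity
  have hx' : r * Real.cos (α - ψ) ≤ Real.cos α := by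
    have := hx k hkn
    rw [rot_rot, real_inner_smul_left, inner_rot_rot, wedge_self, real_inner_self_eq_norm_sq, hkα,
      show k * (2 * α) + α - φ = α - ψ by rw [hψ]; ring] at this
    nlinarith
  have hS : Real.sin (2 * α) = 2 * Real.sin α * Real.cos α := Real.sin_two_mul α
  have hSpos : 0 < Real.sin (2 * α) := by rw [hS]; positivity
  have hsum : Real.sin (2 * α - ψ) + Real.sin ψ = 2 * Real.sin α * Real.cos (α - ψ) := by
    rw [show 2 * α - ψ = α + (α - ψ) by ring, show ψ = α - (α - ψ) by ring, Real.sin_add,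
      Real.sin_sub α (α - ψ)]
    ring_nf
  set a := r * Real.sin (2 * α - ψ) / Real.sin (2 * α) with ha
  set b := r * Real.sin ψ / Real.sin (2 * α) with hb
  have ha0 : 0 ≤ a := div_nonneg (mul_nonneg hr
    (Real.sin_nonneg_of_nonneg_of_le_pi (by linarith) (by linarith))) hSpos.le
  have hb0 : 0 ≤ b := div_nonneg (mul_nonneg hr
    (Real.sin_nonneg_of_nonneg_of_le_pi (by linarith) (by linarith))) hSpos.le
  have hab : a + b ≤ 1 := by
    rw [ha, hb, ← add_div, div_le_one hSpos, ← mul_add, hsum, hS]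
    nlinarith
  have hcomb : r • rot φ w = a • rot (2 * Real.pi * k / n) w +
      b • rot (2 * Real.pi * (k + 1 : ℕ) / n) w := by
    have e1 : 2 * Real.pi * (k + 1 : ℕ) / n = 2 * Real.pi * k / n + 2 * α := by
      rw [hα]; push_cast; ring
    rw [e1, hkα]
    have hne : wedge (rot (k * (2 * α)) w) (rot (k * (2 * α) + 2 * α) w) ≠ 0 := by
      have := wedge_smul_rot (k * (2 * α)) (k * (2 * α) + 2 * α) 1 w
      rw [one_smul] at this
      rw [this, show k * (2 * α) + 2 * α - k * (2 * α) = 2 * α by ring]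
      positivity
    have hD := wedge_smul_rot (k * (2 * α)) (k * (2 * α) + 2 * α) 1 w
    rw [one_smul, show k * (2 * α) + 2 * α - k * (2 * α) = 2 * α by ring] at hD
    conv_lhs => rw [eq_combo_of_wedge_ne_zero hne (r • rot φ w)]
    rw [wedge_smul_rot, wedge_smul_rot', hD,
      show k * (2 * α) + 2 * α - φ = 2 * α - ψ by rw [hψ]; ring, ← hψ]
    congr 2
    · rw [ha]; field_simp
    · rw [hb]; field_simp
  rw [hcomb]
  have := (convex_convexHull ℝ _).sum_mem (t := Finset.univ) (w := ![a, b, 1 - a - b])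
    (z := ![rot (2 * Real.pi * k / n) w, rot (2 * Real.pi * (k + 1 : ℕ) / n) w, 0])
    (by intro i _; fin_cases i <;> simp <;> linarith) (by simp [Fin.sum_univ_three])
    (by
      intro i _
      fin_cases i
      · exact hmem k hkn.le
      · exact hmem (k + 1) hkn
      · exact h0)
  simpa [Fin.sum_univ_three] using this

/-! ### Polar bodies and products of sector areas. -/

theorem convex_polarBody (L : Set Plane) : Convex ℝ (polarBody L) := by
  intro x hx y hy a b ha hb hab z hz
  rw [inner_add_left, real_inner_smul_left, real_inner_smul_left]
  nlinarith [hx z hz, hy z hz]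

theorem isClosed_polarBody (L : Set Plane) : IsClosed (polarBody L) := by
  have : polarBody L = ⋂ y ∈ L, {x : Plane | inner ℝ x y ≤ 1} := by
    ext x; simp [polarBody]
  rw [this]
  exact isClosed_biInter fun y _ => isClosed_le (by fun_prop) continuous_const

theorem zero_mem_polarBody (L : Set Plane) : (0 : Plane) ∈ polarBody L := by
  intro y _; simp

theorem norm_le_of_mem_polarBody {L : Set Plane} {δ : ℝ} (hδ : 0 < δ)
    (h : Metric.closedBall 0 δ ⊆ L) {y : Plane} (hy : y ∈ polarBody L) : ‖y‖ ≤ 1 / δ := by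
  rcases eq_or_ne y 0 with rfl | hy0
  · simp; positivity
  have hn : 0 < ‖y‖ := norm_pos_iff.2 hy0
  have hmem : (δ / ‖y‖) • y ∈ L := by
    apply h
    rw [mem_closedBall_zero_iff, norm_smul, Real.norm_of_nonneg (by positivity)]
    apply le_of_eq; field_simp
  have := hy _ hmem
  rw [real_inner_smul_right, real_inner_self_eq_norm_sq] at this
  rw [le_div_iff₀ hδ]
  have e : δ / ‖y‖ * ‖y‖ ^ 2 = ‖y‖ * δ := by field_simp
  linarith

theorem isCompact_polarBody {L : Set Plane} (h0 : (0 : Plane) ∈ interior L) :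
    IsCompact (polarBody L) := by
  obtain ⟨δ, hδ, hball⟩ := Metric.mem_nhds_iff.1 (mem_interior_iff_mem_nhds.1 h0)
  refine Metric.isCompact_of_isClosed_isBounded (isClosed_polarBody L) ?_
  refine (Metric.isBounded_closedBall (x := (0 : Plane)) (r := 1 / (δ / 2))).subset fun y hy => ?_
  rw [mem_closedBall_zero_iff]
  exact norm_le_of_mem_polarBody (by positivity)
    ((Metric.closedBall_subset_ball (by linarith)).trans hball) hy

theorem rot_mem_polarBody_iff {θ : ℝ} {L : Set Plane} (hsym : ∀ v, rot θ v ∈ L ↔ v ∈ L)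
    (y : Plane) : rot θ y ∈ polarBody L ↔ y ∈ polarBody L := by
  have hin : ∀ v w : Plane, inner ℝ (rot θ v) (rot θ w) = inner ℝ v w := fun v w =>
    (rotIso θ).inner_map_map v w
  constructor
  · intro h x hx
    rw [← hin]
    exact h _ ((hsym x).2 hx)
  · intro h x hx
    have hx' : rot θ (rot (-θ) x) = x := by simp [rot_rot, rot_zero_angle]
    rw [← hx', hin]
    exact h _ ((hsym _).1 (by rwa [hx']))

theorem openCone_smul (P Q : Plane) {a b : ℝ} (ha : 0 < a) (hb : 0 < b) :
    openCone (a • P) (b • Q) = openCone P Q := by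
  ext v
  have h1 : wedge (a • P) v = a * wedge P v := by simp [wedge]; ring
  have h2 : wedge v (b • Q) = b * wedge v Q := by simp [wedge]; ring
  simp only [openCone, mem_ofPred_eq, h1, h2, mul_pos_iff_of_pos_left ha,
    mul_pos_iff_of_pos_left hb]

theorem inner_div_four_le_area_mul_area {L : Set Plane} (hL : Convex ℝ L) (hfin : volume L ≠ ⊤)
    (h0 : (0 : Plane) ∈ L) (hfin' : volume (polarBody L) ≠ ⊤) {P Q P' Q' : Plane}
    (hP : IsRadialEnd L P) (hQ : IsRadialEnd L Q) (hPQ : 0 < wedge P Q)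
    (hP' : IsRadialEnd (polarBody L) P') (hQ' : IsRadialEnd (polarBody L) Q')
    (hPQ' : 0 < wedge P' Q') :
    inner ℝ (Q - P) (Q' - P') / 4 ≤
      volume.real (L ∩ openCone P Q) * volume.real (polarBody L ∩ openCone P' Q') := by
  set A := volume.real (L ∩ openCone P Q)
  have h1 : ∀ x ∈ L, (wedge P x + wedge x Q) / 2 ≤ A := fun x hx =>
    wedge_add_wedge_le_area hL hfin h0 hP hQ hPQ hx
  have hA : 0 < A := by
    have := h1 P hP.1
    rw [wedge_self] at this
    linarith
  -- This vector represents the functional `x ↦ (wedge P x + wedge x Q) / (2 * A)`, which the area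
  -- bound makes at most `1` on `L`.
  set a : Plane := (1 / (2 * A)) • !₂[Q 1 - P 1, -(Q 0 - P 0)] with ha
  have ha' : ∀ x : Plane, inner ℝ a x = (wedge P x + wedge x Q) / 2 / A := by
    intro x
    rw [ha, real_inner_smul_left, plane_inner]
    simp [wedge]; field_simp; ring
  have hmem : a ∈ polarBody L := by
    intro x hx
    rw [ha', div_le_one hA]; exact h1 x hx
  have h2 := wedge_add_wedge_le_area (convex_polarBody L) hfin' (zero_mem_polarBody L) hP' hQ' hPQ'
    hmem
  refine le_trans (le_of_eq ?_) (mul_le_mul_of_nonneg_left h2 hA.le)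
  rw [plane_inner]
  simp [wedge, ha]; field_simp; ring

theorem wedge_add_wedge_rot (α : ℝ) (v x : Plane) :
    wedge v x + wedge x (rot (2 * α) v) = 2 * Real.sin α * inner ℝ x (rot α v) := by
  simp only [wedge, plane_inner, rot_apply_zero, rot_apply_one, Real.cos_two_mul, Real.sin_two_mul]
  have := Real.sin_sq_add_cos_sq α
  linear_combination (2 * (x 0 * v 1 - x 1 * v 0)) * this

/-- Take the last point `r • u` of `L` on the ray and a supporting line there; normalised to value
`1` at that point, its functional is the required polar vector. -/
theorem exists_boundary_support {L : Set Plane} (hL : Convex ℝ L) (hc : IsCompact L)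
    (h0 : (0 : Plane) ∈ interior L) {u : Plane} (hu : u ≠ 0) :
    ∃ r : ℝ, 0 < r ∧ r • u ∈ L ∧ ∃ y ∈ polarBody L, inner ℝ y u = 1 / r := by
  have h0L := interior_subset h0
  set S : Set ℝ := {t | t • u ∈ L} with hS
  have hcont : Continuous fun t : ℝ => t • u := by fun_prop
  have hSc : IsCompact S := by
    refine Metric.isCompact_of_isClosed_isBounded (hc.isClosed.preimage hcont) ?_
    obtain ⟨M, hM⟩ := hc.isBounded.exists_norm_le
    refine (Metric.isBounded_closedBall (x := (0 : ℝ)) (r := M / ‖u‖)).subset fun t ht => ?_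
    have := hM _ ht
    rw [norm_smul] at this
    rw [mem_closedBall_zero_iff, le_div_iff₀ (norm_pos_iff.2 hu)]
    exact this
  obtain ⟨r, hrS, hrmax⟩ := hSc.exists_isMaxOn ⟨0, by simpa [hS] using h0L⟩ continuousOn_id
  have hint : ∀ t : ℝ, t • u ∈ interior L → t < r := by
    intro t ht
    have hnh : {s : ℝ | s • u ∈ interior L} ∈ nhds t :=
      (isOpen_interior.preimage hcont).mem_nhds ht
    obtain ⟨δ, hδ, hb⟩ := Metric.mem_nhds_iff.1 hnh
    have h1 : t + δ / 2 ∈ S := by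
      have hx : t + δ / 2 ∈ Metric.ball t δ := by
        rw [Metric.mem_ball, Real.dist_eq, add_sub_cancel_left, abs_of_pos] <;> linarith
      exact interior_subset (s := L) (hb hx)
    have := hrmax h1
    simp only [id] at this
    change t + δ / 2 ≤ r at this
    linarith
  have hr0 : 0 < r := hint 0 (by simpa using h0)
  have hnot : r • u ∉ interior L := fun h => lt_irrefl _ (hint r h)
  obtain ⟨f, hf⟩ := geometric_hahn_banach_open_point hL.interior isOpen_interior hnot
  have hfpos : 0 < f (r • u) := by simpa using hf 0 h0
  -- Separation is only from the interior; the weak inequality passes to `L`, which lies in the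
  -- closure of its interior.
  have hfL : ∀ x ∈ L, f x ≤ f (r • u) := by
    intro x hx
    have hx' : x ∈ closure (interior L) := by
      rw [hL.closure_interior_eq_closure_of_nonempty_interior ⟨0, h0⟩]
      exact subset_closure hx
    exact closure_minimal (fun y hy => (hf y hy).le) (isClosed_le f.continuous continuous_const) hx'
  set g := (InnerProductSpace.toDual ℝ Plane).symm f with hg
  have hgf : ∀ x, inner ℝ g x = f x := fun x => InnerProductSpace.toDual_symm_apply
  refine ⟨r, hr0, hrS, (1 / f (r • u)) • g, ?_, ?_⟩
  · intro x hx
    rw [real_inner_smul_left, hgf, one_div_mul_eq_div, div_le_one hfpos]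
    exact hfL x hx
  · rw [real_inner_smul_left, hgf]
    have : f (r • u) = r * f u := by simp
    rw [this] at hfpos ⊢
    have : f u ≠ 0 := fun h => by simp [h] at hfpos
    field_simp

theorem isRadialEnd_of_inner {L : Set Plane} {P y : Plane} (hP : P ∈ L) (h : inner ℝ y P = 1)
    (hy : ∀ x ∈ L, inner ℝ y x ≤ 1) : IsRadialEnd L P := by
  refine ⟨hP, fun t ht hmem => ?_⟩
  have := hy _ hmem
  rw [real_inner_smul_right, h] at this
  linarith

/-! ### The volume product about the symmetry centre. -/

/-- The mixed products satisfy `(aB)(bA) ≥ G²`, so by the arithmetic-geometric mean inequality their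
sum is at least `2G`. -/
theorem four_mul_le_add_mul_add {a b A B G : ℝ} (ha : 0 ≤ a) (hb : 0 ≤ b) (hA : 0 ≤ A) (hB : 0 ≤ B)
    (hG : 0 ≤ G) (h1 : G ≤ a * A) (h2 : G ≤ b * B) : 4 * G ≤ (a + b) * (A + B) := by
  have h3 : G ^ 2 ≤ (a * B) * (b * A) := by nlinarith [mul_le_mul h1 h2 hG (by positivity)]
  have h4 : 2 * G ≤ a * B + b * A := by
    apply abs_le_of_sq_le_sq' _ (by positivity) |>.2
    nlinarith [sq_nonneg (a * B - b * A)]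
  nlinarith

/-- Lengths are in units of `‖p‖`. The first bound gives `h ≤ (1 + ε) r`. The second exceeds `s²` by
`(r - c)(1/h - c)`; since `1/h ≥ 1`, a factor `1 - c` cancels, leaving `r - c ≤ ε(1 + c) ≤ 3εc`, as
`c ≥ 1/2`. -/
theorem stability_arith {c s r h ε V : ℝ} (hc : 1 / 2 ≤ c) (hs : 0 < s) (hsc : s ^ 2 + c ^ 2 = 1)
    (hr : c ≤ r) (hrh : r ≤ h) (hh : h ≤ 1) (hε : 0 < ε) (hV1 : s ^ 2 * (h / r) ≤ V)
    (hV2 : r / h + 1 - c * r - c / h ≤ V) (hV : V ≤ (1 + ε) * s ^ 2) :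
    h ≤ (1 + ε) * (1 + 3 * ε) * c := by
  have hr0 : 0 < r := by linarith
  have hh0 : 0 < h := by linarith
  have hs2 : 0 < s ^ 2 := by positivity
  have hc1 : c < 1 := by nlinarith
  have h1 : h ≤ (1 + ε) * r := by
    rw [← div_le_iff₀ hr0]
    nlinarith
  have h2 : (r - c) * (1 / h - c) ≤ ε * ((1 - c) * (1 + c)) := by
    have e : (r - c) * (1 / h - c) = (r / h + 1 - c * r - c / h) - (1 - c ^ 2) := by
      field_simp; ring
    rw [e]; nlinarith
  have h3 : 1 ≤ 1 / h := by rw [le_div_iff₀ hh0]; linarith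
  have h4 : (r - c) * (1 - c) ≤ ε * (1 + c) * (1 - c) := by
    nlinarith [mul_le_mul_of_nonneg_left h3 (sub_nonneg.2 hr)]
  have h5 : r - c ≤ ε * (1 + c) := le_of_mul_le_mul_right h4 (by linarith)
  have h6 : r ≤ (1 + 3 * ε) * c := by nlinarith
  calc h ≤ (1 + ε) * r := h1
    _ ≤ (1 + ε) * ((1 + 3 * ε) * c) := by gcongr
    _ = _ := by ring

set_option maxHeartbeats 1000000 in
/-- The volume product of a planar convex body with `n`-fold symmetry about the origin is at least
that of the regular `n`-gon; near equality the body is thin in the directions halfway between the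
orbit of a point `p` of maximal norm. -/
theorem volume_product_stability {n : ℕ} (hn : 3 ≤ n) {L : Set Plane} (hL : Convex ℝ L)
    (hc : IsCompact L) (h0 : (0 : Plane) ∈ interior L)
    (hsym : ∀ v, rot (2 * Real.pi / n) v ∈ L ↔ v ∈ L) {p : Plane} (hp : p ∈ L) (hp0 : p ≠ 0)
    (hmax : ∀ x ∈ L, ‖x‖ ≤ ‖p‖) :
    (n : ℝ) ^ 2 * Real.sin (Real.pi / n) ^ 2 ≤ volume.real L * volume.real (polarBody L) ∧
    ∃ h : ℝ, 0 < h ∧ h ≤ ‖p‖ ∧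
      (∀ x ∈ L, inner ℝ x (rot (Real.pi / n) (‖p‖⁻¹ • p)) ≤ h) ∧
      ∀ ε : ℝ, 0 < ε → volume.real L * volume.real (polarBody L) ≤
          (1 + ε) * ((n : ℝ) ^ 2 * Real.sin (Real.pi / n) ^ 2) →
        h ≤ (1 + ε) * (1 + 3 * ε) * (‖p‖ * Real.cos (Real.pi / n)) := by
  have hn' : (3 : ℝ) ≤ n := by exact_mod_cast hn
  have hc2 := half_le_cos_pi_div hn
  have hs := sin_pi_div_pos hn
  have hsc := Real.sin_sq_add_cos_sq (Real.pi / n)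
  have h2α : 2 * Real.pi / n = 2 * (Real.pi / n) := by ring
  set α := Real.pi / n with hα
  set c := Real.cos α with hcdef
  set s := Real.sin α with hsdef
  rw [h2α] at hsym
  set ρ := ‖p‖ with hρdef
  have hρ : 0 < ρ := norm_pos_iff.2 hp0
  set e := ρ⁻¹ • p with he
  have hpe : p = ρ • e := by rw [he, smul_smul, mul_inv_cancel₀ hρ.ne', one_smul]
  have hen : ‖e‖ = 1 := by
    rw [he, norm_smul, Real.norm_of_nonneg (by positivity), ← hρdef]; field_simp
  have he0 : e ≠ 0 := by rw [← norm_pos_iff, hen]; exact one_pos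
  have hee : inner ℝ e e = 1 := by rw [real_inner_self_eq_norm_sq, hen]; norm_num
  set u := rot α e with hu
  set e2 := rot (2 * α) e with he2
  have hun : ‖u‖ = 1 := by rw [hu, norm_rot, hen]
  have hu0 : u ≠ 0 := by rw [← norm_pos_iff, hun]; exact one_pos
  have e2n : ‖e2‖ = 1 := by rw [he2, norm_rot, hen]
  have huu : inner ℝ u u = 1 := by rw [real_inner_self_eq_norm_sq, hun]; norm_num
  have hee2 : inner ℝ e2 e2 = 1 := by rw [real_inner_self_eq_norm_sq, e2n]; norm_num
  have heu : inner ℝ e u = c := by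
    have := inner_rot_rot 0 α e e
    rw [rot_zero_angle, hee, wedge_self, sub_zero] at this
    rw [hu, this]; ring
  have hue2 : inner ℝ u e2 = c := by
    have := inner_rot_rot α (2 * α) e e
    rw [hee, wedge_self, show 2 * α - α = α by ring] at this
    rw [hu, he2, this]; ring
  have hue : inner ℝ u e = c := by rw [real_inner_comm, heu]
  have he2u : inner ℝ e2 u = c := by rw [real_inner_comm, hue2]
  have weu : wedge e u = s := by
    have := wedge_rot_rot 0 α e e
    rw [rot_zero_angle, hee, wedge_self, sub_zero] at this
    rw [hu, this]; ring
  have wue2 : wedge u e2 = s := by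
    have := wedge_rot_rot α (2 * α) e e
    rw [hee, wedge_self, show 2 * α - α = α by ring] at this
    rw [hu, he2, this]; ring
  have wee2 : wedge e e2 = 2 * s * c := by
    have := wedge_rot_rot 0 (2 * α) e e
    rw [rot_zero_angle, hee, wedge_self, sub_zero] at this
    rw [he2, this, Real.sin_two_mul]; ring
  have wsm : ∀ (a b : ℝ) (v w : Plane), wedge (a • v) (b • w) = a * b * wedge v w := by
    intro a b v w; simp [wedge]; ring
  have h0L := interior_subset h0
  -- the support and radial functions in the direction `u`
  obtain ⟨x₁, hx₁, hx₁max⟩ := hc.exists_isMaxOn ⟨0, h0L⟩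
    (f := fun x : Plane => inner ℝ x u) (by fun_prop)
  set h := inner ℝ x₁ u with hh
  have hsup : ∀ x ∈ L, inner ℝ x u ≤ h := fun x hx => hx₁max hx
  obtain ⟨r, hr0, hrL, y₁, hy₁, hy₁u⟩ := exists_boundary_support hL hc h0 hu0
  have hrh : r ≤ h := by
    have := hsup _ hrL
    rwa [real_inner_smul_left, huu, mul_one] at this
  have hh0 : 0 < h := hr0.trans_le hrh
  have hhρ : h ≤ ρ := by
    have := real_inner_le_norm x₁ u
    rw [hun, mul_one] at this
    exact this.trans (hmax _ hx₁)
  have hρeL : ρ • e ∈ L := hpe ▸ hp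
  have hρe2L : ρ • e2 ∈ L := by
    rw [he2, ← rot_smul, hsym]; exact hρeL
  -- The midpoint of `ρ • e` and `ρ • e2` is `(ρ * c) • u`, and the functional `y₁` is at most `1`
  -- at both ends.
  have hcr : ρ * c ≤ r := by
    have h1 := hy₁ _ hρeL
    have h2 := hy₁ _ hρe2L
    have h3 : e + e2 = (2 * c) • u := by
      rw [he2, hu]
      apply plane_ext <;> simp [Real.cos_two_mul, Real.sin_two_mul] <;> simp only [← hcdef, ← hsdef]
      · ring
      · ring
    have h4 : inner ℝ y₁ (ρ • e) + inner ℝ y₁ (ρ • e2) = 2 * (ρ * c / r) := by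
      rw [← inner_add_right, ← smul_add, h3, real_inner_smul_right, real_inner_smul_right, hy₁u]
      ring
    rw [← div_le_one hr0]; linarith
  -- radial ends of `L` and its polar
  have hend : ∀ v : Plane, ‖v‖ = 1 → ρ • v ∈ L → IsRadialEnd L (ρ • v) ∧
      IsRadialEnd (polarBody L) (ρ⁻¹ • v) := by
    intro v hv hvL
    have hvv : inner ℝ v v = 1 := by rw [real_inner_self_eq_norm_sq, hv]; norm_num
    -- Maximality of `ρ` enters here: `L` lies in the disc of radius `ρ`.
    have hpol : ρ⁻¹ • v ∈ polarBody L := by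
      intro x hx
      rw [real_inner_smul_left, inv_mul_le_one₀ hρ]
      have := real_inner_le_norm v x
      rw [hv, one_mul] at this
      exact this.trans (hmax x hx)
    have h1 : inner ℝ (ρ⁻¹ • v) (ρ • v) = 1 := by
      rw [real_inner_smul_left, real_inner_smul_right, hvv]; field_simp
    refine ⟨isRadialEnd_of_inner hvL h1 fun x hx => hpol x hx,
      isRadialEnd_of_inner hpol (by rw [real_inner_comm, h1]) fun x hx => ?_⟩
    rw [real_inner_comm]; exact hx _ hvL
  obtain ⟨hP, hP'⟩ := hend e hen hρeL
  obtain ⟨hQ, hQ'⟩ := hend e2 e2n hρe2L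
  have hU : IsRadialEnd L (r • u) :=
    isRadialEnd_of_inner hrL (y := y₁) (by rw [real_inner_smul_right, hy₁u]; field_simp)
      fun x hx => hy₁ x hx
  have hupol : h⁻¹ • u ∈ polarBody L := by
    intro x hx
    rw [real_inner_smul_left, inv_mul_le_one₀ hh0, real_inner_comm]
    exact hsup x hx
  have hU' : IsRadialEnd (polarBody L) (h⁻¹ • u) :=
    isRadialEnd_of_inner hupol (y := x₁)
      (by rw [real_inner_smul_right, ← hh]; field_simp)
      fun y hy => by rw [real_inner_comm]; exact hy _ hx₁
  have hfin : volume L ≠ ⊤ := hc.measure_lt_top.ne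
  have hMc := isCompact_polarBody h0
  have hfin' : volume (polarBody L) ≠ ⊤ := hMc.measure_lt_top.ne
  have hMsym := rot_mem_polarBody_iff hsym
  have hi : 0 < ρ⁻¹ := by positivity
  have hhi : 0 < h⁻¹ := by positivity
  -- the large sectors
  have big1 : ρ * s * h ≤ volume.real (L ∩ openCone e e2) := by
    have := wedge_add_wedge_le_area hL hfin h0L hP hQ (by rw [wsm, wee2]; positivity) hx₁
    rw [openCone_smul _ _ hρ hρ] at this
    refine le_trans (le_of_eq ?_) this
    rw [he2, ← rot_smul, wedge_add_wedge_rot, rot_smul, ← hu, real_inner_smul_right, ← hh,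
      ← hsdef]
    ring
  have big2 : ρ⁻¹ * s * (1 / r) ≤ volume.real (polarBody L ∩ openCone e e2) := by
    have := wedge_add_wedge_le_area (convex_polarBody L) hfin' (zero_mem_polarBody L) hP' hQ'
      (by rw [wsm, wee2]; positivity) hy₁
    rw [openCone_smul _ _ hi hi] at this
    refine le_trans (le_of_eq ?_) this
    rw [he2, ← rot_smul, wedge_add_wedge_rot, rot_smul, ← hu, real_inner_smul_right, hy₁u,
      ← hsdef]
    ring
  have vol1 := card_mul_volume_openCone_le hn he0 hc.measurableSet hfin (by rw [h2α]; exact hsym)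
  have vol2 := card_mul_volume_openCone_le hn he0 hMc.measurableSet hfin' (by rw [h2α]; exact hMsym)
  -- the small sectors
  have wol1 := card_mul_volume_add_le hn he0 hc.measurableSet hfin (by rw [h2α]; exact hsym)
  have wol2 := card_mul_volume_add_le hn he0 hMc.measurableSet hfin' (by rw [h2α]; exact hMsym)
  rw [h2α] at vol1 vol2 wol1 wol2
  rw [← he2] at vol1 vol2
  rw [← hα, ← hu, ← he2] at wol1 wol2
  have sm1 := inner_div_four_le_area_mul_area hL hfin h0L hfin' hP hU
    (by rw [wsm, weu]; positivity) hP' hU' (by rw [wsm, weu]; positivity)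
  have sm2 := inner_div_four_le_area_mul_area hL hfin h0L hfin' hU hQ
    (by rw [wsm, wue2]; positivity) hU' hQ' (by rw [wsm, wue2]; positivity)
  rw [openCone_smul _ _ hρ hr0, openCone_smul _ _ hi hhi] at sm1
  rw [openCone_smul _ _ hr0 hρ, openCone_smul _ _ hhi hi] at sm2
  set V := volume.real L * volume.real (polarBody L) / n ^ 2 with hV
  have hVmul : volume.real L * volume.real (polarBody L) = V * n ^ 2 := by
    rw [hV]; field_simp
  set G := (r / h + 1 - c * (r / ρ) - c * (ρ / h)) / 4 with hG
  have g1 : inner ℝ (r • u - ρ • e) (h⁻¹ • u - ρ⁻¹ • e) / 4 = G := by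
    simp only [inner_sub_left, inner_sub_right, real_inner_smul_left, real_inner_smul_right, huu,
      hee, hue, heu]
    rw [hG]; field_simp; ring
  have g2 : inner ℝ (ρ • e2 - r • u) (ρ⁻¹ • e2 - h⁻¹ • u) / 4 = G := by
    simp only [inner_sub_left, inner_sub_right, real_inner_smul_left, real_inner_smul_right, huu,
      hee2, hue2, he2u]
    rw [hG]; field_simp; ring
  rw [g1] at sm1
  rw [g2] at sm2
  have hr' : c ≤ r / ρ := by rw [le_div_iff₀ hρ]; linarith
  have hh1 : h / ρ ≤ 1 := (div_le_one hρ).2 hhρ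
  have hrh' : r / ρ ≤ h / ρ := by gcongr
  have hGpos : 0 ≤ G := by
    -- Both factors of the product are nonnegative because `ρ * c ≤ r` and `h ≤ ρ`.
    have e4 : G = ((r / ρ - c) * (ρ / h - c) + s ^ 2) / 4 := by
      rw [hG, show s ^ 2 = 1 - c ^ 2 by linarith]; field_simp; ring
    have : 1 ≤ ρ / h := by rw [le_div_iff₀ hh0]; linarith
    have hc1 : c ≤ 1 := Real.cos_le_one _
    have : 0 ≤ (r / ρ - c) * (ρ / h - c) := mul_nonneg (by linarith) (by linarith)
    rw [e4]; positivity
  have four := four_mul_le_add_mul_add measureReal_nonneg measureReal_nonneg measureReal_nonneg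
    measureReal_nonneg hGpos sm1 sm2
  have hV1 : s ^ 2 * ((h / ρ) / (r / ρ)) ≤ V := by
    have e1 : s ^ 2 * ((h / ρ) / (r / ρ)) = (ρ * s * h) * (ρ⁻¹ * s * (1 / r)) := by field_simp
    rw [e1, hV, le_div_iff₀ (by positivity)]
    calc _ = (n * (ρ * s * h)) * (n * (ρ⁻¹ * s * (1 / r))) := by ring
      _ ≤ _ := mul_le_mul ((mul_le_mul_of_nonneg_left big1 (by positivity)).trans vol1)
          ((mul_le_mul_of_nonneg_left big2 (by positivity)).trans vol2) (by positivity)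
          measureReal_nonneg
  have hV2 : (r / ρ) / (h / ρ) + 1 - c * (r / ρ) - c / (h / ρ) ≤ V := by
    have e1 : (r / ρ) / (h / ρ) + 1 - c * (r / ρ) - c / (h / ρ) = 4 * G := by
      rw [hG]; field_simp
    rw [e1, hV, le_div_iff₀ (by positivity)]
    refine (mul_le_mul_of_nonneg_right four (by positivity)).trans ?_
    have wol3 := mul_le_mul wol1 wol2 (mul_nonneg (Nat.cast_nonneg n)
      (add_nonneg measureReal_nonneg measureReal_nonneg)) measureReal_nonneg
    refine le_trans (le_of_eq ?_) wol3
    rw [mul_mul_mul_comm, pow_two, mul_comm]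
  refine ⟨?_, h, hh0, hhρ, hsup, fun ε hε hvol => ?_⟩
  · rw [hVmul, mul_comm]
    have : 1 ≤ (h / ρ) / (r / ρ) := by rw [le_div_iff₀ (by positivity)]; linarith
    gcongr
    nlinarith [sq_nonneg s]
  · have hVε : V ≤ (1 + ε) * s ^ 2 := by
      rw [hV, div_le_iff₀ (by positivity)]; linarith
    have := stability_arith hc2 hs hsc hr' hrh' hh1 hε hV1 hV2 hVε
    rw [div_le_iff₀ hρ] at this
    linarith

/-! ### Moving the pole of polarity away from the centre. -/

theorem integral_inner_eq_zero_of_rot {n : ℕ} (hn : 2 ≤ n) {M : Set Plane} (hM : IsCompact M)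
    (hsym : ∀ v, rot (2 * Real.pi / n) v ∈ M ↔ v ∈ M) (z : Plane) :
    ∫ y in M, inner ℝ z y = 0 := by
  have hint : IntegrableOn (fun y : Plane => y) M := continuous_id.continuousOn.integrableOn_compact hM
  have h0 : ∫ y in M, y = 0 := by
    apply eq_zero_of_rot_eq (cos_two_pi_div_ne_one hn)
    have h1 : ∫ y in M, rot (2 * Real.pi / n) y = rot (2 * Real.pi / n) (∫ y in M, y) :=
      (rotIso (2 * Real.pi / n)).toContinuousLinearEquiv.toContinuousLinearMap.integral_comp_comm
        hint
    rw [← h1]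
    have h2 := (measurePreserving_rot (2 * Real.pi / n)).setIntegral_preimage_emb
      (rotIso (2 * Real.pi / n)).toHomeomorph.measurableEmbedding (fun y => y) M
    rw [← h2]
    congr 2
    ext v; exact (hsym v).symm
  rw [integral_inner hint, h0, inner_zero_right]

/-- The projective map that carries the polar body to the polar body with respect to `z`. -/
noncomputable def polarShift (z y : Plane) : Plane := (1 - inner ℝ z y)⁻¹ • y

/-- The derivative of `polarShift z`. -/
noncomputable def polarShiftDeriv (z y : Plane) : Plane →L[ℝ] Plane :=
  (1 - inner ℝ z y)⁻¹ • ContinuousLinearMap.id ℝ Plane +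
    (((1 - inner ℝ z y) ^ 2)⁻¹ • innerSL ℝ z).smulRight y

theorem hasFDerivAt_polarShift {z y : Plane} (h : 1 - inner ℝ z y ≠ 0) :
    HasFDerivAt (polarShift z) (polarShiftDeriv z y) y := by
  have h1 : HasFDerivAt (fun y : Plane => 1 - inner ℝ z y) (-(innerSL ℝ z)) y :=
    ((innerSL ℝ z).hasFDerivAt).const_sub 1
  have h2 := (hasDerivAt_inv h).comp_hasFDerivAt y h1
  have h3 := h2.smul (hasFDerivAt_id y)
  refine h3.congr_fderiv ?_
  ext v
  simp [polarShiftDeriv]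

/-- With `t = 1 - ⟨z,y⟩` the derivative is `t⁻¹` times the identity plus a rank-one map; its
eigenvalues are `t⁻¹` and `t⁻¹ + t⁻²(1 - t) = t⁻²`. -/
theorem det_polarShiftDeriv {z y : Plane} (h : 1 - inner ℝ z y ≠ 0) :
    (polarShiftDeriv z y).det = ((1 - inner ℝ z y) ^ 3)⁻¹ := by
  have hdet : (polarShiftDeriv z y).det = LinearMap.det (polarShiftDeriv z y : Plane →ₗ[ℝ] Plane) :=
    rfl
  rw [hdet, plane_det]
  have e := plane_inner z y
  simp only [wedge, polarShiftDeriv, ContinuousLinearMap.coe_coe, add_apply,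
    smul_apply, ContinuousLinearMap.id_apply,
    ContinuousLinearMap.smulRight_apply, innerSL_apply_apply, PiLp.add_apply, PiLp.smul_apply,
    smul_eq_mul, plane_inner z !₂[1, 0], plane_inner z !₂[0, 1]]
  simp
  set a := inner ℝ z y with ha
  field_simp
  linear_combination (a - 1) * e

theorem injOn_polarShift {z : Plane} {M : Set Plane} (h : ∀ y ∈ M, inner ℝ z y < 1) :
    InjOn (polarShift z) M := by
  intro y hy y' hy' heq
  have h1 := h y hy
  have h2 := h y' hy'
  have d1 : 1 - inner ℝ z y ≠ 0 := by linarith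
  have d2 : 1 - inner ℝ z y' ≠ 0 := by linarith
  have h3 := congrArg (fun v => 1 + inner ℝ z v) heq
  simp only [polarShift, real_inner_smul_right] at h3
  have h4 : (1 - inner ℝ z y)⁻¹ = (1 - inner ℝ z y')⁻¹ := by
    calc (1 - inner ℝ z y)⁻¹ = 1 + (1 - inner ℝ z y)⁻¹ * inner ℝ z y := by field_simp; ring
      _ = 1 + (1 - inner ℝ z y')⁻¹ * inner ℝ z y' := h3
      _ = _ := by field_simp; ring
  simp only [polarShift, h4] at heq
  exact smul_right_injective Plane (inv_ne_zero d2) heq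

theorem inner_lt_one_of_mem_interior {L : Set Plane} {z y : Plane} (hz : z ∈ interior L)
    (hy : y ∈ polarBody L) : inner ℝ z y < 1 := by
  have hcont : Continuous fun t : ℝ => t • z := by fun_prop
  have hnh : {t : ℝ | t • z ∈ interior L} ∈ nhds (1 : ℝ) :=
    (isOpen_interior.preimage hcont).mem_nhds (by simpa using hz)
  obtain ⟨δ, hδ, hb⟩ := Metric.mem_nhds_iff.1 hnh
  have hx : 1 + δ / 2 ∈ Metric.ball 1 δ := by
    rw [Metric.mem_ball, Real.dist_eq, add_sub_cancel_left, abs_of_pos] <;> linarith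
  have := hy _ (interior_subset (s := L) (hb hx))
  rw [real_inner_smul_right, real_inner_comm] at this
  by_contra hge
  nlinarith

/-- Negative `u` must be allowed, since `⟨z,y⟩` takes both signs on the polar; the quadratic
refinement below is used only where `u ≥ 0`. -/
theorem one_add_le_inv_one_sub_cube {u : ℝ} (hu : u < 1) : 1 + 3 * u ≤ ((1 - u) ^ 3)⁻¹ := by
  have : 0 < (1 - u) ^ 3 := pow_pos (by linarith) 3
  rw [← one_div, le_div_iff₀ this]
  have e : (1 + 3 * u) * (1 - u) ^ 3 = 1 - u ^ 2 * (2 / 3 + 3 * (u - 4 / 3) ^ 2) := by ring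
  rw [e]
  nlinarith [mul_nonneg (sq_nonneg u) (by positivity : 0 ≤ 2 / 3 + 3 * (u - 4 / 3) ^ 2)]

theorem one_add_add_le_inv_one_sub_cube {u : ℝ} (hu0 : 0 ≤ u) (hu : u < 1) :
    1 + 3 * u + 6 * u ^ 2 ≤ ((1 - u) ^ 3)⁻¹ := by
  have : 0 < (1 - u) ^ 3 := pow_pos (by linarith) 3
  rw [← one_div, le_div_iff₀ this]
  have e : (1 + 3 * u + 6 * u ^ 2) * (1 - u) ^ 3 = 1 - u ^ 3 * (10 - 15 * u + 6 * u ^ 2) := by ring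
  rw [e]
  have : 0 ≤ 10 - 15 * u + 6 * u ^ 2 := by nlinarith [sq_nonneg (u - 5 / 4)]
  nlinarith [mul_nonneg (pow_nonneg hu0 3) this]

/-- The image of the polar under `polarShift z` has area `∫ (1 - ⟨z,y⟩)⁻³`. Bound the integrand
below by `1 + 3⟨z,y⟩`, whose linear part integrates to zero, and keep the quadratic term on one
small disc where `⟨z,y⟩` is bounded below. -/
theorem volume_polarBody_shift_ge {n : ℕ} (hn : 2 ≤ n) {L K : Set Plane} {z : Plane}
    (hz : z ∈ interior L) (hsym : ∀ v, rot (2 * Real.pi / n) v ∈ L ↔ v ∈ L) {ρ : ℝ} (hρ : 0 < ρ)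
    (hLρ : ∀ x ∈ L, ‖x‖ ≤ ρ) (hball : Metric.closedBall 0 (ρ / 2) ⊆ L)
    (hK : ∀ x ∈ K, x + z ∈ L) (hfin : volume (polarBody K) ≠ ⊤) :
    volume.real (polarBody L) * (1 + 3 / 128 * (‖z‖ / ρ) ^ 2) ≤ volume.real (polarBody K) := by
  have h0 : (0 : Plane) ∈ interior L := by
    rw [mem_interior_iff_mem_nhds]
    exact Filter.mem_of_superset (Metric.closedBall_mem_nhds 0 (by positivity)) hball
  set M := polarBody L with hMdef
  have hM : IsCompact M := isCompact_polarBody h0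
  have hlt : ∀ y ∈ M, inner ℝ z y < 1 := fun y hy => inner_lt_one_of_mem_interior hz hy
  have himage : polarShift z '' M ⊆ polarBody K := by
    rintro _ ⟨y, hy, rfl⟩ x hx
    have h1 := hy _ (hK x hx)
    have h2 := hlt y hy
    rw [inner_add_right, real_inner_comm z y] at h1
    rw [polarShift, real_inner_smul_left, inv_mul_le_one₀ (by linarith)]
    linarith
  have hvol : ∫ y in M, ((1 - inner ℝ z y) ^ 3)⁻¹ = volume.real (polarShift z '' M) := by
    have := integral_image_eq_integral_abs_det_fderiv_smul volume hM.measurableSet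
      (fun y hy => (hasFDerivAt_polarShift (z := z) (y := y)
        (by linarith [hlt y hy])).hasFDerivWithinAt) (injOn_polarShift hlt) (fun _ => (1 : ℝ))
    rw [setIntegral_const, smul_eq_mul, mul_one] at this
    rw [this]
    refine setIntegral_congr_fun hM.measurableSet fun y hy => ?_
    have h1 : 0 < 1 - inner ℝ z y := by linarith [hlt y hy]
    simp only [smul_eq_mul, mul_one]
    rw [det_polarShiftDeriv h1.ne', abs_of_pos (by positivity)]
  -- The disc of radius `1/(4ρ)` about `q` stays in the disc of radius `1/ρ`, and on it `⟨z,y⟩ ≥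
  -- (3/4 - 1/4)‖z‖/ρ`. For `z = 0` the convention `0⁻¹ = 0` gives `q = 0`.
  set q : Plane := (3 / (4 * ρ)) • (‖z‖⁻¹ • z) with hq
  set B := Metric.closedBall q (1 / (4 * ρ)) with hB
  have hunit : ‖‖z‖⁻¹ • z‖ ≤ 1 := by
    rw [norm_smul, norm_inv, norm_norm]
    exact inv_mul_le_one
  have hqn : ‖q‖ ≤ 3 / (4 * ρ) := by
    rw [hq, norm_smul, Real.norm_of_nonneg (by positivity)]
    exact mul_le_of_le_one_right (by positivity) hunit
  have hqz : inner ℝ z q = 3 / (4 * ρ) * ‖z‖ := by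
    rw [hq, real_inner_smul_right, real_inner_smul_right, real_inner_self_eq_norm_sq]
    rcases eq_or_ne ‖z‖ 0 with h | h
    · simp [h]
    · field_simp
  have hBM : B ⊆ M := by
    intro y hy x hx
    rw [hB, mem_closedBall_iff_norm] at hy
    have h1 : ‖y‖ ≤ 1 / ρ := by
      calc ‖y‖ = ‖q + (y - q)‖ := by congr 1; abel
        _ ≤ ‖q‖ + ‖y - q‖ := norm_add_le _ _
        _ ≤ 3 / (4 * ρ) + 1 / (4 * ρ) := add_le_add hqn hy
        _ = 1 / ρ := by field_simp; norm_num
    calc inner ℝ y x ≤ ‖y‖ * ‖x‖ := real_inner_le_norm y x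
      _ ≤ 1 / ρ * ρ := mul_le_mul h1 (hLρ x hx) (norm_nonneg _) (by positivity)
      _ = 1 := by field_simp
  have hBz : ∀ y ∈ B, ‖z‖ / (2 * ρ) ≤ inner ℝ z y := by
    intro y hy
    rw [hB, mem_closedBall_iff_norm] at hy
    have h1 : inner ℝ z y = inner ℝ z q + inner ℝ z (y - q) := by
      rw [← inner_add_right]; congr 1; abel
    have h2 := neg_le_of_abs_le (abs_real_inner_le_norm z (y - q))
    have h3 : ‖z‖ * ‖y - q‖ ≤ ‖z‖ * (1 / (4 * ρ)) := by gcongr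
    rw [h1, hqz]
    have h4 : ‖z‖ / (2 * ρ) = 3 / (4 * ρ) * ‖z‖ - ‖z‖ * (1 / (4 * ρ)) := by field_simp; ring
    linarith
  set κ := 6 * (‖z‖ / (2 * ρ)) ^ 2 with hκ
  have hfinM : volume M ≠ ⊤ := hM.measure_lt_top.ne
  -- The ratio of the radii `2/ρ` and `1/(4ρ)` is `8`. The gain is thus `6 · (1/4) / 64 = 3/128`
  -- times `(‖z‖/ρ)²`.
  have hMB : volume.real M ≤ 64 * volume.real B := by
    have h1 : M ⊆ Metric.closedBall 0 (2 / ρ) := by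
      intro y hy
      rw [mem_closedBall_zero_iff]
      have := norm_le_of_mem_polarBody (by positivity) hball hy
      rwa [one_div_div] at this
    have h2 := measureReal_mono h1 (μ := volume) (isCompact_closedBall _ _).measure_lt_top.ne
    refine h2.trans (le_of_eq ?_)
    rw [hB, Measure.addHaar_real_closedBall _ _ (by positivity),
      Measure.addHaar_real_closedBall _ _ (by positivity)]
    simp; field_simp; ring
  have i1 : IntegrableOn (fun _ : Plane => (1 : ℝ)) M := continuousOn_const.integrableOn_compact hM
  have i2 : IntegrableOn (fun y : Plane => 3 * inner ℝ z y) M :=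
    ContinuousOn.integrableOn_compact hM (by fun_prop)
  have hBm : MeasurableSet B := Metric.isClosed_closedBall.measurableSet
  have i3 : IntegrableOn (B.indicator fun _ : Plane => κ) M :=
    (continuousOn_const.integrableOn_compact hM).indicator hBm
  have i4 : IntegrableOn (fun y : Plane => ((1 - inner ℝ z y) ^ 3)⁻¹) M := by
    refine ContinuousOn.integrableOn_compact hM (ContinuousOn.inv₀ (by fun_prop) fun y hy => ?_)
    exact pow_ne_zero 3 (by linarith [hlt y hy])
  have hmono : ∫ y in M, ((1 + 3 * inner ℝ z y) + B.indicator (fun _ => κ) y) ≤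
      ∫ y in M, ((1 - inner ℝ z y) ^ 3)⁻¹ := by
    refine setIntegral_mono_on ((i1.add i2).add i3) i4 hM.measurableSet fun y hy => ?_
    by_cases hyB : y ∈ B
    · rw [indicator_of_mem hyB]
      have h1 := hBz y hyB
      have h2 : 0 ≤ ‖z‖ / (2 * ρ) := by positivity
      refine le_trans ?_ (one_add_add_le_inv_one_sub_cube (h2.trans h1) (hlt y hy))
      rw [hκ]
      gcongr
    · rw [indicator_of_notMem hyB, add_zero]
      exact one_add_le_inv_one_sub_cube (hlt y hy)
  have i12 : IntegrableOn (fun y : Plane => 1 + 3 * inner ℝ z y) M := i1.add i2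
  rw [integral_add i12 i3, integral_add i1 i2, integral_const_mul,
    integral_inner_eq_zero_of_rot hn hM (rot_mem_polarBody_iff hsym), setIntegral_indicator hBm,
    inter_eq_self_of_subset_right hBM, setIntegral_const, setIntegral_const, hvol] at hmono
  have hle := measureReal_mono himage hfin
  simp only [smul_eq_mul, mul_one, mul_zero, add_zero] at hmono
  have hκ' : κ = 3 / 2 * (‖z‖ / ρ) ^ 2 := by rw [hκ]; field_simp; ring
  have hpos : 0 ≤ (‖z‖ / ρ) ^ 2 := by positivity
  rw [hκ'] at hmono
  nlinarith [mul_le_mul_of_nonneg_right hMB hpos]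

/-! ### Trapping the body between two homothetic polygons. -/

theorem rot_mem_interior {θ : ℝ} {L : Set Plane} (hsym : ∀ v, rot θ v ∈ L ↔ v ∈ L) {v : Plane}
    (hv : v ∈ interior L) : rot θ v ∈ interior L := by
  have hopen : IsOpen (rotIso θ '' interior L) :=
    (rotIso θ).toHomeomorph.isOpenMap _ isOpen_interior
  refine interior_maximal ?_ hopen (mem_image_of_mem _ hv)
  rintro _ ⟨x, hx, rfl⟩
  exact (hsym x).2 (interior_subset hx)

theorem nfold_stability {n : ℕ} (hn : 3 ≤ n) {K : Set Plane} (hK : IsPlanarConvexBody K)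
    (hsym : IsNFoldSymmetric n K) (ho : (0 : Plane) ∈ interior K) {ε : ℝ} (hε : 0 < ε)
    (hvol : volume.real K * volume.real (polarBody K) ≤
      (1 + ε) * ((n : ℝ) ^ 2 * Real.sin (Real.pi / n) ^ 2)) :
    ∃ s p : Plane, p ≠ 0 ∧ (∀ v, rot (2 * Real.pi / n) v + s ∈ K ↔ v + s ∈ K) ∧ p + s ∈ K ∧
      ‖s‖ ^ 2 ≤ 128 / 3 * ε * ‖p‖ ^ 2 ∧ ∃ τ : ℝ, 0 < τ ∧ τ ≤ 1 + 18 * ε ∧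
        ∀ x, x + s ∈ K →
          x ∈ τ • convexHull ℝ {q | ∃ k : ℕ, k < n ∧ q = rot (2 * Real.pi * k / n) p} := by
  obtain ⟨s, hs⟩ := hsym
  have hsc : 0 < Real.sin (Real.pi / n) := sin_pi_div_pos hn
  have hc := half_le_cos_pi_div hn
  have hn0 : (0 : ℝ) < n := by positivity
  set L : Set Plane := (Homeomorph.addRight s) ⁻¹' K with hL
  have memL : ∀ x, x ∈ L ↔ x + s ∈ K := fun x => Iff.rfl
  have hLsym : ∀ v, rot (2 * Real.pi / n) v ∈ L ↔ v ∈ L := by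
    intro v
    rw [memL, memL]
    constructor
    · intro h
      rw [HasNFoldSymmetryAbout] at hs
      rw [← hs] at h
      obtain ⟨y, hy, hyv⟩ := h
      have h1 : rot (2 * Real.pi / n) (y - s) = rot (2 * Real.pi / n) v := by
        have : s + rot (2 * Real.pi / n) (y - s) = s + rot (2 * Real.pi / n) v := by
          rw [add_comm s (rot _ v)]; exact hyv
        exact add_left_cancel this
      have h2 : y - s = v := (rotIso (2 * Real.pi / n)).injective h1
      rwa [← h2, sub_add_cancel]
    · intro h
      have : s + rot (2 * Real.pi / n) (v + s - s) ∈ K := by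
        have h3 := mem_image_of_mem (fun y : Plane => s + rot (2 * Real.pi / n) (y - s)) h
        rw [HasNFoldSymmetryAbout] at hs
        rwa [hs] at h3
      rwa [add_sub_cancel_right, add_comm] at this
  have hLconv : Convex ℝ L := hK.convex.translate_preimage_left s
  have hLcomp : IsCompact L := (Homeomorph.addRight s).isCompact_preimage.2 hK.isCompact
  have hLvol : volume.real L = volume.real K := by
    rw [Measure.real, Measure.real]
    congr 1
    exact measure_preimage_add_right volume s K
  have hz : -s ∈ interior L := by
    rw [hL, ← (Homeomorph.addRight s).preimage_interior]
    simpa using ho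
  have hint : ∀ v, rot (2 * Real.pi / n) v ∈ interior L ↔ v ∈ interior L := by
    refine fun v => ⟨fun h => ?_, rot_mem_interior hLsym⟩
    have hinv : ∀ w, rot (-(2 * Real.pi / n)) w ∈ L ↔ w ∈ L := by
      intro w
      rw [← hLsym, rot_rot, add_neg_cancel, rot_zero_angle]
    have := rot_mem_interior hinv h
    rwa [rot_rot, neg_add_cancel, rot_zero_angle] at this
  have h0 : (0 : Plane) ∈ interior L :=
    -- The centre is the average of the orbit of the interior point `-s`.
    zero_mem_of_rot_mem (by omega) hLconv.interior fun k _ => (rot_mem_iff hint k (-s)).2 hz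
  obtain ⟨p, hp, hpmax⟩ := hLcomp.exists_isMaxOn ⟨0, interior_subset h0⟩ continuous_norm.continuousOn
  have hmax : ∀ x ∈ L, ‖x‖ ≤ ‖p‖ := fun x hx => hpmax hx
  have hp0 : p ≠ 0 := by
    rintro rfl
    have h1 : L ⊆ {0} := fun x hx => by simpa using hmax x hx
    have h2 := interior_mono h1 h0
    simp at h2
  have hρ : 0 < ‖p‖ := norm_pos_iff.2 hp0
  obtain ⟨hlow, h, hh0, hhρ, hhsup, hstab⟩ :=
    volume_product_stability hn hLconv hLcomp h0 hLsym hp hp0 hmax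
  have hhull : convexHull ℝ {q | ∃ k : ℕ, k < n ∧ q = rot (2 * Real.pi * k / n) p} ⊆ L := by
    apply convexHull_min _ hLconv
    rintro _ ⟨k, _, rfl⟩
    exact (rot_mem_iff hLsym k p).2 hp
  -- The polygon spanned by the orbit of `p` has inradius `‖p‖ cos(π/n) ≥ ‖p‖/2`.
  have hball : Metric.closedBall 0 (‖p‖ / 2) ⊆ L := by
    intro x hx
    rw [mem_closedBall_zero_iff] at hx
    apply hhull
    apply mem_convexHull_regular hn hp0
    intro k _
    refine (real_inner_le_norm _ _).trans ?_
    rw [norm_rot, norm_rot]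
    nlinarith
  have hshift := volume_polarBody_shift_ge (K := K) (by omega) hz hLsym hρ hmax hball
    (fun x hx => by rw [memL, neg_add_cancel_right]; exact hx) (isCompact_polarBody ho).measure_lt_top.ne
  rw [norm_neg] at hshift
  rw [← hLvol] at hvol
  set N := (n : ℝ) ^ 2 * Real.sin (Real.pi / n) ^ 2 with hN
  have hNpos : 0 < N := by positivity
  set W := volume.real L
  set M := volume.real (polarBody L)
  have hW : 0 ≤ W := measureReal_nonneg
  have hM : 0 ≤ M := measureReal_nonneg
  have hWM : 0 < W * M := hNpos.trans_le hlow
  have hprod : W * M * (1 + 3 / 128 * (‖s‖ / ‖p‖) ^ 2) ≤ (1 + ε) * N := by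
    rw [mul_assoc]
    exact (mul_le_mul_of_nonneg_left hshift hW).trans hvol
  have hsq : 0 ≤ (‖s‖ / ‖p‖) ^ 2 := by positivity
  have hvolL : W * M ≤ (1 + ε) * N := by
    nlinarith [mul_nonneg hWM.le hsq]
  have hsmall : (‖s‖ / ‖p‖) ^ 2 ≤ 128 / 3 * ε := by
    -- The sharp lower bound `hlow` replaces `N` by `W * M`, which then cancels.
    have h1 : W * M * (1 + 3 / 128 * (‖s‖ / ‖p‖) ^ 2) ≤ W * M * (1 + ε) := by
      refine hprod.trans ?_
      rw [mul_comm]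
      gcongr
    have := le_of_mul_le_mul_left h1 hWM
    linarith
  have hcpos : 0 < Real.cos (Real.pi / n) := by linarith
  refine ⟨s, p, hp0, hLsym, hp, ?_, h / (‖p‖ * Real.cos (Real.pi / n)), by positivity, ?_, ?_⟩
  · rwa [div_pow, div_le_iff₀ (by positivity)] at hsmall
  · rw [div_le_iff₀ (by positivity)]
    -- For `ε ≤ 1`, `(1 + ε)(1 + 3ε) ≤ 1 + 7ε`; for larger `ε` the trivial bound `1/cos(π/n) ≤ 2` is
    -- enough.
    by_cases hε1 : ε ≤ 1
    · refine (hstab ε hε hvolL).trans ?_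
      gcongr
      nlinarith
    · push Not at hε1
      refine hhρ.trans ?_
      nlinarith [mul_le_mul_of_nonneg_left hc hρ.le, mul_pos hρ hcpos]
  · intro x hx
    set τ := h / (‖p‖ * Real.cos (Real.pi / n)) with hτ
    have hτ0 : 0 < τ := by positivity
    rw [mem_smul_set_iff_inv_smul_mem₀ hτ0.ne']
    apply mem_convexHull_regular hn hp0
    intro k _
    have hx' : rot (2 * Real.pi * k / n) (rot (-(2 * Real.pi * k / n)) x) = x := by
      rw [rot_rot, add_neg_cancel, rot_zero_angle]
    have hmem : rot (-(2 * Real.pi * k / n)) x ∈ L := by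
      rw [← rot_mem_iff hLsym k, hx']; exact hx
    have h1 := hhsup _ hmem
    rw [rot_smul, real_inner_smul_right] at h1
    have h2 : inner ℝ x (rot (2 * Real.pi * k / n) (rot (Real.pi / n) p)) =
        inner ℝ (rot (-(2 * Real.pi * k / n)) x) (rot (Real.pi / n) p) := by
      conv_lhs => rw [← hx']
      exact (rotIso (2 * Real.pi * k / n)).inner_map_map _ _
    rw [real_inner_smul_left, h2, inv_mul_le_iff₀ hτ0]
    rw [inv_mul_le_iff₀ hρ] at h1
    refine h1.trans (le_of_eq ?_)
    rw [hτ]; field_simp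

/-! ### Similarity to an arbitrary regular polygon. -/

theorem regular_hull_eq_image (n : ℕ) (c p : Plane) (r φ : ℝ) :
    convexHull ℝ {q | ∃ k : ℕ, k < n ∧ q = c + rot (2 * Real.pi * k / n) (r • rot φ p)} =
      (fun q => c + r • rot φ q) ''
        convexHull ℝ {q | ∃ k : ℕ, k < n ∧ q = rot (2 * Real.pi * k / n) p} := by
  let F : Plane →ᵃ[ℝ] Plane := AffineMap.const ℝ Plane c +
    (r • ((rotIso φ).toLinearEquiv : Plane →ₗ[ℝ] Plane)).toAffineMap
  have hF : ∀ q, F q = c + r • rot φ q := fun q => rfl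
  have h := F.image_convexHull {q | ∃ k : ℕ, k < n ∧ q = rot (2 * Real.pi * k / n) p}
  change _ = F '' _
  rw [h]
  congr 1
  have hcomm : ∀ k : ℕ, rot (2 * Real.pi * k / n) (r • rot φ p) =
      r • rot φ (rot (2 * Real.pi * k / n) p) := by
    intro k; rw [rot_smul, rot_rot, rot_rot, add_comm]
  ext q
  constructor
  · rintro ⟨k, hk, rfl⟩
    exact ⟨_, ⟨k, hk, rfl⟩, by rw [hF, hcomm]⟩
  · rintro ⟨_, ⟨k, hk, rfl⟩, rfl⟩
    exact ⟨k, hk, by rw [hF, hcomm]⟩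

theorem mem_similarityRatios {n : ℕ} {K : Set Plane} (hK : Convex ℝ K) {s p : Plane} (hp0 : p ≠ 0)
    (hsym : ∀ v, rot (2 * Real.pi / n) v + s ∈ K ↔ v + s ∈ K) (hp : p + s ∈ K) {τ : ℝ} (hτ : 0 < τ)
    (hsub : ∀ x, x + s ∈ K →
      x ∈ τ • convexHull ℝ {q | ∃ k : ℕ, k < n ∧ q = rot (2 * Real.pi * k / n) p})
    {c : Plane} {R : Set Plane} (hR : IsRegularNGon n c R) : τ ∈ similarityRatios K R := by
  obtain ⟨v, hv0, rfl⟩ := hR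
  obtain ⟨r, φ, hr, -, -, rfl⟩ := exists_eq_smul_rot hp0 v
  have hr0 : r ≠ 0 := by rintro rfl; simp at hv0
  have hk : r / τ ≠ 0 := div_ne_zero hr0 hτ.ne'
  have hhull : ∀ q ∈ convexHull ℝ {q | ∃ k : ℕ, k < n ∧ q = rot (2 * Real.pi * k / n) p},
      q + s ∈ K := by
    have hconv : Convex ℝ ((fun x => x + s) ⁻¹' K) := hK.translate_preimage_left s
    refine fun q hq => convexHull_min ?_ hconv hq
    rintro _ ⟨k, _, rfl⟩
    exact (rot_mem_iff (L := (fun x => x + s) ⁻¹' K) hsym k p).2 hp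
  -- Sends `s` to `c` and scales so that the outer polygon, the `τ`-dilate, becomes `R`; the ratios
  -- are then `1` and `τ`.
  let A : Plane ≃ᵈ Plane :=
    ((IsometryEquiv.subRight s).trans (rotIso φ).toIsometryEquiv).toDilationEquiv.trans
      (DilationEquiv.smulTorsor c hk)
  have hA : ∀ y, A y = (r / τ) • rot φ (y - s) + c := fun y => rfl
  rw [regular_hull_eq_image]
  refine ⟨1, τ, A, c - τ • c, one_pos, hτ, ?_, ?_, (div_one τ).symm⟩
  · rw [one_smul]
    rintro _ ⟨y, hy, rfl⟩
    obtain ⟨q, hq, hqy⟩ := hsub (y - s) (by rwa [sub_add_cancel])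
    refine ⟨q, hq, ?_⟩
    change τ • q = y - s at hqy
    rw [hA, ← hqy, rot_smul, smul_smul, div_mul_cancel₀ _ hτ.ne', add_comm]
  · rintro _ ⟨q, hq, rfl⟩
    refine ⟨τ • A (q + s), ⟨A (q + s), ⟨q + s, hhull q hq, rfl⟩, rfl⟩, ?_⟩
    simp only [hA, add_sub_cancel_right, vadd_eq_add, smul_add, smul_smul]
    rw [mul_div_cancel₀ _ hτ.ne']
    abel

/-! ### Distance of the polygon's centre from the origin. -/

theorem le_mul_sqrt_mul_of_sq_le {k t ε a : ℝ} (hk : 0 ≤ k) (hε : 0 ≤ ε) (ha : 0 ≤ a)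
    (h : t ^ 2 ≤ k ^ 2 * ε * a ^ 2) : t ≤ k * Real.sqrt ε * a := by
  apply abs_le_of_sq_le_sq' _ (by positivity) |>.2
  rwa [mul_pow, mul_pow, Real.sq_sqrt hε]

/-- With `a = l₁‖v‖`, `b = l₂‖v‖`, the numerical estimates behind `norm_center_le`. -/
theorem center_arith {a b ε s p d e f : ℝ} (ha : 0 < a) (hε : 0 < ε) (hε1 : 18 * ε < 1)
    (hb0 : 0 ≤ b) (hb : b ≤ (1 + 18 * ε) * a) (hs : s ^ 2 ≤ 128 / 3 * ε * p ^ 2)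
    (hp : p ^ 2 ≤ b ^ 2) (hde : d ^ 2 + e ^ 2 ≤ b ^ 2 - a ^ 2)
    (hf : f ^ 2 ≤ 2 * (d ^ 2 + e ^ 2)) : s + 1 / 2 * f ≤ 20 * Real.sqrt ε * a := by
  have ha2 : 0 < a ^ 2 := by positivity
  have hbsq : b ^ 2 ≤ (1 + 18 * ε) ^ 2 * a ^ 2 := by
    rw [← mul_pow]; gcongr
  have hquad : (1 + 18 * ε) ^ 2 ≤ 1 + 54 * ε := by nlinarith
  have hb2 : b ^ 2 ≤ (1 + 54 * ε) * a ^ 2 :=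
    hbsq.trans (mul_le_mul_of_nonneg_right hquad ha2.le)
  have hb4 : b ^ 2 ≤ 4 * a ^ 2 := by nlinarith
  -- `4 · 128/3 < 14²`; for `f` below, `2 · 54 < 12²`.
  have hs' : s ≤ 14 * Real.sqrt ε * a := by
    apply le_mul_sqrt_mul_of_sq_le (by norm_num) hε.le ha.le
    have h5 := mul_le_mul_of_nonneg_left (hp.trans hb4) (by positivity : 0 ≤ 128 / 3 * ε)
    nlinarith [mul_pos hε ha2]
  have hf' : f ≤ 12 * Real.sqrt ε * a := by
    apply le_mul_sqrt_mul_of_sq_le (by norm_num) hε.le ha.le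
    nlinarith [mul_pos hε ha2]
  linarith

/-- `K` lies in the circumscribed disc of the outer polygon and contains the vertices of the inner
one. Averaging over orbits makes the offsets of both polygon centres from `s` at most of order `√ε`;
the centre in question is the mean of these two, and `s` itself is already small. -/
theorem norm_center_le {n : ℕ} (hn : 3 ≤ n) {K : Set Plane} {s p : Plane}
    (hsym : ∀ v, rot (2 * Real.pi / n) v + s ∈ K ↔ v + s ∈ K) (hp : p + s ∈ K) {ε : ℝ} (hε : 0 < ε)
    (hs : ‖s‖ ^ 2 ≤ 128 / 3 * ε * ‖p‖ ^ 2) {c x : Plane} {R : Set Plane} {l₁ l₂ : ℝ}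
    (hR : IsRegularNGon n c R) (hl₁ : 0 < l₁) (hl₂ : 0 < l₂) (h1 : x +ᵥ l₁ • R ⊆ K)
    (h2 : K ⊆ x +ᵥ l₂ • R) (hl : l₂ / l₁ ≤ 1 + 18 * ε)
    (hcos : 1 + 18 * ε < 1 / Real.cos (Real.pi / n)) :
    ‖((l₁ + l₂) / 2) • c + x‖ ≤ 263 * Real.sqrt ε * Metric.diam (((l₁ + l₂) / 2) • R) := by
  obtain ⟨v, hv0, hRv⟩ := hR
  have hc := half_le_cos_pi_div hn
  have hε18 : 18 * ε < 1 := by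
    have : 1 / Real.cos (Real.pi / n) ≤ 2 := by
      rw [div_le_iff₀ (by linarith)]; linarith
    linarith
  rw [div_le_iff₀ hl₁] at hl
  have hL : ∀ k : ℕ, ∀ w, rot (2 * Real.pi * k / n) w + s ∈ K ↔ w + s ∈ K := fun k w =>
    rot_mem_iff (L := (fun x => x + s) ⁻¹' K) hsym k w
  have hcR : c ∈ R := by
    have himg := regular_hull_eq_image n c v 1 0
    simp only [one_smul, rot_zero_angle] at himg
    rw [hRv, himg]
    refine ⟨0, ?_, by simp⟩
    exact zero_mem_of_rot_mem (by omega) (convex_convexHull ℝ _)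
      fun k hk => subset_convexHull ℝ _ ⟨k, hk, rfl⟩
  have hvR : ∀ k < n, c + rot (2 * Real.pi * k / n) v ∈ R := fun k hk => by
    rw [hRv]; exact subset_convexHull ℝ _ ⟨k, hk, rfl⟩
  have hRball : ∀ y ∈ R, ‖y - c‖ ≤ ‖v‖ := by
    intro y hy
    rw [← mem_closedBall_iff_norm]
    rw [hRv] at hy
    refine convexHull_min ?_ (convex_closedBall c ‖v‖) hy
    rintro _ ⟨k, _, rfl⟩
    rw [mem_closedBall_iff_norm, add_sub_cancel_left, norm_rot]
  have hKball : ∀ y, y + s ∈ K → ‖(s - (x + l₂ • c)) + y‖ ^ 2 ≤ (l₂ * ‖v‖) ^ 2 := by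
    intro y hy
    obtain ⟨_, ⟨q, hq, rfl⟩, hqy⟩ := h2 hy
    have e : (s - (x + l₂ • c)) + y = l₂ • (q - c) := by
      change x + l₂ • q = y + s at hqy
      rw [smul_sub]
      have : y = x + l₂ • q - s := by rw [hqy]; abel
      rw [this]; abel
    rw [e, norm_smul, Real.norm_of_nonneg hl₂.le]
    gcongr
    exact hRball q hq
  set d := s - (x + l₂ • c) with hd
  set e := x + l₁ • c - s with he
  have hp2 : ‖d‖ ^ 2 + ‖p‖ ^ 2 ≤ (l₂ * ‖v‖) ^ 2 :=
    norm_sq_add_norm_sq_le_of_rot (n := n) (by omega) fun k _ => hKball _ ((hL k p).2 hp)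
  -- Two averagings: over the vertices of the inner polygon, indexed by `j`, and over the symmetries
  -- of `K` about `s`, indexed by `k`.
  have hde : ‖d‖ ^ 2 + ‖e‖ ^ 2 ≤ (l₂ * ‖v‖) ^ 2 - (l₁ * ‖v‖) ^ 2 := by
    refine norm_sq_add_norm_sq_le_of_rot (n := n) (by omega) fun k _ => ?_
    have := norm_sq_add_norm_sq_le_of_rot (n := n) (by omega)
      (d := d + rot (2 * Real.pi * k / n) e) (e := rot (2 * Real.pi * k / n) (l₁ • v))
      (M := (l₂ * ‖v‖) ^ 2) (fun j hj => by
        have hmem : (e + l₁ • rot (2 * Real.pi * j / n) v) + s ∈ K := by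
          apply h1
          refine ⟨l₁ • (c + rot (2 * Real.pi * j / n) v), ⟨_, hvR j hj, rfl⟩, ?_⟩
          simp only [vadd_eq_add, smul_add, he]
          abel
        have h3 := hKball _ ((hL k _).2 hmem)
        rw [rot_add, ← rot_smul, rot_rot, ← add_assoc] at h3
        rwa [rot_rot, add_comm (2 * Real.pi * j / n)])
    rw [norm_rot, norm_smul, Real.norm_of_nonneg hl₁.le] at this
    linarith
  set m := (l₁ + l₂) / 2 with hm
  have hm0 : 0 < m := by positivity
  have hdiam : m * ‖v‖ ≤ Metric.diam (m • R) := by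
    have hbdd : Bornology.IsBounded (m • R) := by
      apply Bornology.IsBounded.smul₀
      refine (Metric.isBounded_closedBall (x := c) (r := ‖v‖)).subset fun y hy => ?_
      rw [mem_closedBall_iff_norm]; exact hRball y hy
    have := Metric.dist_le_diam_of_mem hbdd (smul_mem_smul_set (a := m) (hvR 0 (by omega)))
      (smul_mem_smul_set (a := m) hcR)
    rwa [dist_eq_norm, ← smul_sub, add_sub_cancel_left, norm_smul, norm_rot,
      Real.norm_of_nonneg hm0.le] at this
  have hcenter : m • c + x = s + (1 / 2 : ℝ) • (e - d) := by
    rw [he, hd, hm]; module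
  have hv : 0 < ‖v‖ := norm_pos_iff.2 hv0
  have hb : l₂ * ‖v‖ ≤ (1 + 18 * ε) * (l₁ * ‖v‖) := by
    rw [← mul_assoc]; gcongr
  have hed : ‖e - d‖ ^ 2 ≤ 2 * (‖d‖ ^ 2 + ‖e‖ ^ 2) := by
    have := parallelogram_law_with_norm ℝ e d
    linarith [mul_self_nonneg ‖e + d‖, pow_two ‖e - d‖, pow_two ‖d‖, pow_two ‖e‖]
  have key := center_arith (mul_pos hl₁ hv) hε hε18 (by positivity) hb hs
    (by linarith [sq_nonneg ‖d‖]) hde hed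
  have hlv := mul_pos hl₂ hv
  -- From `l₁ ≤ l₁ + l₂ = 2 * m`, and the circumradius of `m • R` is at most its diameter.
  have ham : l₁ * ‖v‖ ≤ 2 * Metric.diam (m • R) := by
    have : m * ‖v‖ = (l₁ * ‖v‖ + l₂ * ‖v‖) / 2 := by rw [hm]; ring
    linarith
  rw [hcenter]
  calc ‖s + (1 / 2 : ℝ) • (e - d)‖ ≤ ‖s‖ + 1 / 2 * ‖e - d‖ := by
        refine (norm_add_le _ _).trans ?_
        rw [norm_smul]; norm_num
    _ ≤ 20 * Real.sqrt ε * (l₁ * ‖v‖) := key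
    _ ≤ 20 * Real.sqrt ε * (2 * Metric.diam (m • R)) := by gcongr
    _ = 40 * Real.sqrt ε * Metric.diam (m • R) := by ring
    _ ≤ 263 * Real.sqrt ε * Metric.diam (m • R) :=
        mul_le_mul_of_nonneg_right (mul_le_mul_of_nonneg_right (by norm_num) (Real.sqrt_nonneg ε))
          Metric.diam_nonneg

theorem theorem5 (n : ℕ) (hn : 3 ≤ n) (K : Set Plane) (hK : IsPlanarConvexBody K)
    (hsym : IsNFoldSymmetric n K) (ho : (0 : Plane) ∈ interior K) (ε : ℝ) (hε : 0 < ε)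
    (hvol : volume.real K * volume.real (polarBody K) ≤
      (1 + ε) * ((n : ℝ) ^ 2 * Real.sin (Real.pi / n) ^ 2)) :
    (∀ (c : Plane) (R : Set Plane), IsRegularNGon n c R →
      similarityBanachMazur K R ≤ 1 + 18 * ε ∧
      ∃ ρ ∈ similarityRatios K R, ρ ≤ 1 + 18 * ε) ∧
    (∀ (c x : Plane) (R : Set Plane) (l₁ l₂ : ℝ), IsRegularNGon n c R → 0 < l₁ → 0 < l₂ →
      x +ᵥ l₁ • R ⊆ K → K ⊆ x +ᵥ l₂ • R →
      l₂ / l₁ ≤ 1 + 18 * ε → 1 + 18 * ε < 1 / Real.cos (Real.pi / n) →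
      ‖((l₁ + l₂) / 2) • c + x‖ ≤
        263 * Real.sqrt ε * Metric.diam (((l₁ + l₂) / 2) • R)) := by
  obtain ⟨s, p, hp0, hs, hp, hsmall, τ, hτ0, hτ, hsub⟩ :=
    nfold_stability hn hK hsym ho hε hvol
  refine ⟨fun c R hR => ?_, fun c x R l₁ l₂ hR hl₁ hl₂ h1 h2 hl hcos =>
    norm_center_le hn hs hp hε hsmall hR hl₁ hl₂ h1 h2 hl hcos⟩
  have hmem := mem_similarityRatios hK.convex hp0 hs hp hτ0 hsub hR
  refine ⟨(csInf_le ⟨0, ?_⟩ hmem).trans hτ, τ, hmem, hτ⟩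
  rintro _ ⟨l₁, l₂, _, _, hl₁, hl₂, _, _, rfl⟩
  positivity
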